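/- Let $g\ge 0$ and $n,s>0$ be integers and let $\underline r=(r_1,\dots,r_s)$ be positive integers with $\sum_{i=1}^s(r_i-1)=2g-2+n$. Notation. On the charge-zero semi-infinite wedge (Fock) space with vacuum $|0\rangle$, let $E_{ij}$ ($i,j\in\mathbb Z+\frac12$) be the operators which, for $i\neq j$, replace the factor $v_j$ of a wedge by $v_i$ and, for $i=j$, are the normally ordered number operators (so $E_{ii}|0\rangle=0$). Put $\varsigma(u)=e^{u/2}-e^{-u/2}$ and, for $m\in\mathbb Z$, $$\mathcal E_m(u)=\sum_{l\in\mathbb Z+\frac12}e^{u(l-m/2)}E_{l-m,l}+\frac{\delta_{m,0}}{\varsigma(u)},\qquad J_m=\mathcal E_m(0)\ (m\ne0),$$ and let $\mathcal F_r^k$ be $r!$ times the coefficient of $u^r$ in $\mathcal E_{-k}(u)$. For tuples of positive integers $\mu,\nu$ and $\underline k\in\mathbb Z^s$, the completed cycles leaky Hurwitz number is $$h^{\underline k,\underline r}_{g;\mu,\nu}=\frac1{\prod_i\mu_i\prod_j\nu_j}\Big\langle 0\Big|\prod_i J_{\mu_i}\ \frac{\mathcal F^{k_1}_{r_1}}{r_1}\cdots\frac{\mathcal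 F^{k_s}_{r_s}}{r_s}\ \prod_j J_{-\nu_j}\Big|0\Big\rangle .$$ For $\mathbf x\in\mathbb Z^n$ let $\mathbf x^+$ be the tuple of positive entries of $\mathbf x$ and $\mathbf x^-$ the tuple of absolute values of its negative entries. In the real hyperplane $\mathcal H=\{(\mathbf x,\underline k)\in\mathbb R^n\times\mathbb R^s:\sum_i x_i=\sum_j k_j\}$ consider the leaky resonance arrangement, i.e. the walls $\sum_{i\in I}x_i=\sum_{j\in J}k_j$ for $I\subseteq\{1,\dots,n\}$, $J\subseteq\{1,\dots,s\}$, where $(I,J)$ is neither $(\emptyset,\emptyset)$ nor $(\{1,\dots,n\},\{1,\dots,s\})$. Its chambers are the connected components of the complement of the walls in $\mathcal H$. Theorem. The map $(\mathbf x,\underline k)\mapsto h^{\underline k,\underline r}_{g;\mathbf x^+,\mathbf x^-}$ on the integral points of $\mathcal H$ is piecewise polynomial with respect to the leaky resonance arrangement, jointly in $\mathbf x$ and $\underline k$: for every chamber $C$ there is a polynomial $P\in\mathbb Q[x_1,\dots,x_n,k_1,\dots,k_s]$ of total degree at most $d=1+\sum_{i=1}^s r_i-n$ such that $h^{\underline k,\underline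 r}_{g;\mathbf x^+,\mathbf x^-}=P(\mathbf x,\underline k)$ at all integral points of $C$. Moreover, unless the map vanishes at all integral points of $C$, its degree on $C$ is exactly $d$: every polynomial in $\mathbb Q[x_1,\dots,x_n,k_1,\dots,k_s]$ that agrees with it at all integral points of $C$ has total degree at least $d$. -/

import Mathlib

noncomputable section

namespace LeakyHurwitz

/-- Basis of the charge-zero semi-infinite wedge space. The integer `a` stands for the half-integer
`a + 1/2`, so the negative half-integers are the `a < 0`. A basis wedge is given by the set `S` of
the half-integers that occur in it: almost all negative ones and almost no positive ones, with as
many positive ones present as negative ones missing. -/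
structure Maya where
  carrier : Set ℤ
  finite_pos : (carrier \ Set.Iio 0).Finite
  finite_neg : (Set.Iio 0 \ carrier).Finite
  charge_zero : (carrier \ Set.Iio 0).ncard = (Set.Iio 0 \ carrier).ncard

/-- The vacuum: exactly the negative half-integers occur. -/
def Maya.vacuum : Maya where
  carrier := Set.Iio 0
  finite_pos := by simp
  finite_neg := by simp
  charge_zero := rfl

/-- Replace `j` by `i`. -/
def Maya.move (S : Maya) (i j : ℤ) (hj : j ∈ S.carrier) (hi : i ∉ S.carrier) : Maya where
  carrier := insert i (S.carrier \ {j})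
  finite_pos := (S.finite_pos.insert i).subset (by
    rintro a ⟨ha, ha0⟩
    rcases ha with rfl | ha
    · exact Set.mem_insert _ _
    · exact Set.mem_insert_of_mem _ ⟨ha.1, ha0⟩)
  finite_neg := (S.finite_neg.insert j).subset (by
    rintro a ⟨ha0, ha⟩
    by_cases haj : a = j
    · exact haj ▸ Set.mem_insert _ _
    · exact Set.mem_insert_of_mem _ ⟨ha0, fun h => ha (Set.mem_insert_of_mem _ ⟨h, haj⟩)⟩)
  charge_zero := by
    have hne : i ≠ j := fun h => hi (h ▸ hj)
    have hc := S.charge_zero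
    have fp := S.finite_pos
    have fn := S.finite_neg
    by_cases hi0 : i < 0 <;> by_cases hj0 : j < 0
    · have e1 : insert i (S.carrier \ {j}) \ Set.Iio 0 = S.carrier \ Set.Iio 0 := by
        ext a; simp only [Set.mem_sdiff, Set.mem_insert_iff, Set.mem_singleton_iff, Set.mem_Iio]
        grind
      have e2 : Set.Iio 0 \ insert i (S.carrier \ {j})
          = insert j ((Set.Iio 0 \ S.carrier) \ {i}) := by
        ext a; simp only [Set.mem_sdiff, Set.mem_insert_iff, Set.mem_singleton_iff, Set.mem_Iio]
        grind
      rw [e1, e2, Set.ncard_exchange (by simp [hj]) (by simp [hi, hi0]), hc]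
    · have e1 : insert i (S.carrier \ {j}) \ Set.Iio 0 = (S.carrier \ Set.Iio 0) \ {j} := by
        ext a; simp only [Set.mem_sdiff, Set.mem_insert_iff, Set.mem_singleton_iff, Set.mem_Iio]
        grind
      have e2 : Set.Iio 0 \ insert i (S.carrier \ {j}) = (Set.Iio 0 \ S.carrier) \ {i} := by
        ext a; simp only [Set.mem_sdiff, Set.mem_insert_iff, Set.mem_singleton_iff, Set.mem_Iio]
        grind
      rw [e1, e2, Set.ncard_sdiff_singleton_of_mem (by simpa [hj] using hj0),
        Set.ncard_sdiff_singleton_of_mem (by simp [hi, hi0]), hc]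
    · have e1 : insert i (S.carrier \ {j}) \ Set.Iio 0 = insert i (S.carrier \ Set.Iio 0) := by
        ext a; simp only [Set.mem_sdiff, Set.mem_insert_iff, Set.mem_singleton_iff, Set.mem_Iio]
        grind
      have e2 : Set.Iio 0 \ insert i (S.carrier \ {j}) = insert j (Set.Iio 0 \ S.carrier) := by
        ext a; simp only [Set.mem_sdiff, Set.mem_insert_iff, Set.mem_singleton_iff, Set.mem_Iio]
        grind
      rw [e1, e2, Set.ncard_insert_of_notMem (by simp [hi]) fp,
        Set.ncard_insert_of_notMem (by simp [hj]) fn, hc]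
    · have e1 : insert i (S.carrier \ {j}) \ Set.Iio 0
          = insert i ((S.carrier \ Set.Iio 0) \ {j}) := by
        ext a; simp only [Set.mem_sdiff, Set.mem_insert_iff, Set.mem_singleton_iff, Set.mem_Iio]
        grind
      have e2 : Set.Iio 0 \ insert i (S.carrier \ {j}) = Set.Iio 0 \ S.carrier := by
        ext a; simp only [Set.mem_sdiff, Set.mem_insert_iff, Set.mem_singleton_iff, Set.mem_Iio]
        grind
      rw [e1, e2, Set.ncard_exchange (by simp [hi]) (by simpa [hj] using hj0), hc]

/-- Charge-zero fermionic Fock space (with rational coefficients). -/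
abbrev Fock : Type := Maya →₀ ℚ

open Classical in
/-- The operator `E_{ij}` on a basis wedge: for `i ≠ j` it replaces `v_j` by `v_i` inside the wedge
(the sign comes from moving the new factor to its place in the decreasing order); for `i = j` it is
the normally ordered number operator, which kills the vacuum. -/
def matrixUnitBasis (i j : ℤ) (S : Maya) : Fock :=
  if i = j then
    ((if j ∈ S.carrier then (1 : ℚ) else 0) - (if j < 0 then 1 else 0)) • Finsupp.single S 1
  else if h : j ∈ S.carrier ∧ i ∉ S.carrier then
    (-1 : ℚ) ^ (S.carrier ∩ Set.Ioo (min i j) (max i j)).ncard •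
      Finsupp.single (S.move i j h.1 h.2) 1
  else 0

/-- The power series `ς(u) = 2 sinh(u/2) = e^{u/2} - e^{-u/2}`. -/
def varsigma : PowerSeries ℚ :=
  PowerSeries.rescale (1 / 2) (PowerSeries.exp ℚ) -
    PowerSeries.rescale (-1 / 2) (PowerSeries.exp ℚ)

/-- The power series `𝒮(u) = ς(u) / u`. -/
def calS : PowerSeries ℚ :=
  PowerSeries.mk fun m => PowerSeries.coeff (m + 1) varsigma

/-- The coefficient of `u ^ r` in the operator
`ℰ_n(u) = ∑_{l ∈ ℤ + 1/2} e^{u (l - n/2)} E_{l-n, l} + δ_{n,0} / ς(u)`, where `l = a + 1/2`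
and `1 / ς(u) = u⁻¹ 𝒮(u)⁻¹`. The sum is finite on every basis wedge (see
`finite_support_calE`). -/
def calE (n : ℤ) (r : ℕ) : Module.End ℚ Fock :=
  Finsupp.linearCombination ℚ (fun S : Maya =>
    ∑ᶠ a : ℤ, ((((a : ℚ) + 1 / 2) - (n : ℚ) / 2) ^ r / (r.factorial : ℚ)) •
      matrixUnitBasis (a - n) a S) +
  (if n = 0 then PowerSeries.coeff (r + 1) calS⁻¹ else 0) • (1 : Module.End ℚ Fock)

theorem finite_support_calE (n : ℤ) (r : ℕ) (S : Maya) :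
    (Function.support fun a : ℤ => ((((a : ℚ) + 1 / 2) - (n : ℚ) / 2) ^ r / (r.factorial : ℚ)) •
      matrixUnitBasis (a - n) a S).Finite := by
  refine Set.Finite.subset ((S.finite_pos.union S.finite_neg).union
    ((S.finite_neg.image (· + n)).union (Set.finite_Icc (-|n|) |n|))) ?_
  intro a ha
  by_contra hcon
  apply ha
  simp only [Set.mem_union, Set.mem_sdiff, Set.mem_Iio, Set.mem_image, Set.mem_Icc, not_or,
    not_and, not_exists, not_not] at hcon
  obtain ⟨⟨h1, h2⟩, h3, h4⟩ := hcon
  have h3' := h3 (a - n)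
  have hz : matrixUnitBasis (a - n) a S = 0 := by
    unfold matrixUnitBasis
    split_ifs with e1 e2 e3 e4 e5
    · simp
    · exact absurd (h1 e2) e3
    · exact absurd (h2 e4) e2
    · simp
    · exfalso
      have ha0 : a < 0 := h1 e5.1
      have hn0 : 0 ≤ a - n := by
        by_contra hlt
        exact h3' ⟨by omega, e5.2⟩ (by ring)
      have := abs_nonneg n
      have := neg_abs_le n
      exact h4 (by omega) (by omega)
    · rfl
  simp only [hz, smul_zero]

/-- The Heisenberg operators `J_n = ℰ_n(0)`, for `n ≠ 0`. -/
def J (n : ℤ) : Module.End ℚ Fock := calE n 0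

/-- The `k`-leaky `r`-completed cycles cut-and-join operator `ℱ_r^k`, defined by
`ℰ_{-k}(u) = ∑_r ℱ_r^k u^r / r!`. -/
def cutJoin (r : ℕ) (k : ℤ) : Module.End ℚ Fock := (r.factorial : ℚ) • calE (-k) r

/-- Vacuum expectation value `⟨0| A |0⟩`. -/
def vev (A : Module.End ℚ Fock) : ℚ := A (Finsupp.single Maya.vacuum 1) Maya.vacuum

/-- The completed cycles leaky Hurwitz number
`(∏ μ_i ∏ ν_j)⁻¹ ⟨ ∏ J_{μ_i} · ∏_{i=1}^s ℱ_{r_i}^{k_i} / r_i · ∏ J_{-ν_j} ⟩`.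
The genus is determined by `∑ (r_i - 1) = 2 g - 2 + ℓ(μ) + ℓ(ν)`. -/
def hurwitz {s : ℕ} (k : Fin s → ℤ) (r : Fin s → ℕ) (μ ν : List ℕ) : ℚ :=
  ((μ.map fun m => (m : ℚ)).prod * (ν.map fun m => (m : ℚ)).prod)⁻¹ *
    vev ((μ.map fun m => J (m : ℤ)).prod *
      (List.ofFn fun i => (r i : ℚ)⁻¹ • cutJoin (r i) (k i)).prod *
      (ν.map fun m => J (-(m : ℤ))).prod)

/-- The positive entries of `x`. -/
def posPart {n : ℕ} (x : Fin n → ℤ) : List ℕ :=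
  ((List.ofFn x).filter fun a => 0 < a).map Int.natAbs

/-- The absolute values of the negative entries of `x`. -/
def negPart {n : ℕ} (x : Fin n → ℤ) : List ℕ :=
  ((List.ofFn x).filter fun a => a < 0).map Int.natAbs

/-- The map `(x, k) ↦ h^{k, r}_{g; x⁺, x⁻}`. -/
def hurwitzMap {n s : ℕ} (r : Fin s → ℕ) (x : Fin n → ℤ) (k : Fin s → ℤ) : ℚ :=
  hurwitz k r (posPart x) (negPart x)

/-- The hyperplane `∑ x_i = ∑ k_j` (its real points). -/
def hyperplane (n s : ℕ) : Set ((Fin n → ℝ) × (Fin s → ℝ)) :=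
  {z | ∑ i, z.1 i = ∑ j, z.2 j}

/-- The wall `W_{IJ}` inside the hyperplane. -/
def wall {n s : ℕ} (I : Finset (Fin n)) (T : Finset (Fin s)) :
    Set ((Fin n → ℝ) × (Fin s → ℝ)) :=
  {z | z ∈ hyperplane n s ∧ ∑ i ∈ I, z.1 i = ∑ j ∈ T, z.2 j}

/-- The complement of the leaky resonance arrangement in the hyperplane. The pairs `(∅, ∅)` and
`(univ, univ)`, for which the equation of the wall holds on the whole hyperplane, do not define a
wall. -/
def arrangementComplement (n s : ℕ) : Set ((Fin n → ℝ) × (Fin s → ℝ)) :=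
  {z | z ∈ hyperplane n s ∧ ∀ (I : Finset (Fin n)) (T : Finset (Fin s)),
    ¬ (I = ∅ ∧ T = ∅) → ¬ (I = Finset.univ ∧ T = Finset.univ) → z ∉ wall I T}

/-- Chambers: the connected components of the complement of the arrangement. -/
def IsChamber {n s : ℕ} (C : Set ((Fin n → ℝ) × (Fin s → ℝ))) : Prop :=
  ∃ z ∈ arrangementComplement n s, C = connectedComponentIn (arrangementComplement n s) z

/-- The integral point `(x, k)` lies in `C`. -/
def MemInt {n s : ℕ} (x : Fin n → ℤ) (k : Fin s → ℤ)
    (C : Set ((Fin n → ℝ) × (Fin s → ℝ))) : Prop :=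
  ((fun i => (x i : ℝ), fun j => (k j : ℝ)) : (Fin n → ℝ) × (Fin s → ℝ)) ∈ C

/-- The polynomial `P` in the variables `x` and `k` agrees with `(x, k) ↦ h^{k, r}_{g; x⁺, x⁻}` at
all integral points of `C`. -/
def Represents {n s : ℕ} (r : Fin s → ℕ) (C : Set ((Fin n → ℝ) × (Fin s → ℝ)))
    (P : MvPolynomial (Fin n ⊕ Fin s) ℚ) : Prop :=
  ∀ (x : Fin n → ℤ) (k : Fin s → ℤ), MemInt x k C →
    hurwitzMap r x k =
      MvPolynomial.eval (Sum.elim (fun i => (x i : ℚ)) (fun j => (k j : ℚ))) P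

end LeakyHurwitz

end

namespace LeakyHurwitz

/-! On a chamber the energy of every non-empty proper set of coordinates (the sum of its `x_i` minus
the sum of its `k_j`) has constant non-zero sign. Operators of negative energy are moved to the
left, where they pair to zero with the covacuum; those of positive energy kill the vacuum on the
right. The commutator of two operators is again an operator with a polynomial symbol, attached to
the union of the two sets of coordinates (`bandOp_commutator`, `symbolOp_mul`). Hence the terms that
arise depend only on the chamber. A central term appears only in the last commutator, between
complementary sets: it is the sum of a symbol over `m` centred points of spacing 1
(`cocycle_eq_gridSum`), which is `m` times a polynomial by Faulhaber's formula.

With centred symbols a commutator picks out odd parts of shifts. Commuting with a Heisenberg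
operator therefore yields the factor `|x_i|` and lowers the degree of the symbol by one; the factors
`|x_i|` cancel the prefactor of the Hurwitz number. The last step adds one to the degree, which
gives `1 + ∑ r_j - n` (`exists_commutator`, `isEvaluated_pair`, `isEvaluated`).

The degree is exact because nothing cancels: the shifts are halves of absolute energies, so all
coefficients stay non-negative on the chamber, and centred power sums are non-negative. A power sum
that is non-zero at `m` grows along `t * m` at the full rate (`exists_gridSum_growth`). Thus a
non-zero value at one integral point forces growth of order `t ^ d` on its ray, which bounds the
degree of any representing polynomial from below (`SharpPoly.le_totalDegree`). -/

/-! ### Fermions and their anticommutation relations -/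

/-- Sets of integers with finitely many non-negative elements: the basis of the semi-infinite wedge
space of arbitrary charge. -/
abbrev Config : Type := {S : Set ℤ // (S \ Set.Iio 0).Finite}

theorem Config.finite_inter_Ioi (S : Config) (i : ℤ) : (S.1 ∩ Set.Ioi i).Finite := by
  refine (S.2.union (Set.finite_Ioo i 0)).subset ?_
  rintro a ⟨ha, hai⟩
  by_cases h : a < 0
  · exact Or.inr ⟨hai, h⟩
  · exact Or.inl ⟨ha, h⟩

/-- Insert a factor. -/
def Config.insert (i : ℤ) (S : Config) : Config :=
  ⟨Insert.insert i S.1, (S.2.insert i).subset (by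
    rintro a ⟨rfl | ha, h⟩
    · exact Set.mem_insert _ _
    · exact Set.mem_insert_of_mem _ ⟨ha, h⟩)⟩

/-- Remove a factor. -/
def Config.erase (i : ℤ) (S : Config) : Config :=
  ⟨S.1 \ {i}, S.2.subset (by rintro a ⟨ha, h⟩; exact ⟨ha.1, h⟩)⟩

/-- The sign for moving a new factor `i` past the larger ones. -/
noncomputable def Config.sign (i : ℤ) (S : Config) : ℚ := (-1) ^ (S.1 ∩ Set.Ioi i).ncard

theorem Config.sign_mul_self (i : ℤ) (S : Config) : S.sign i * S.sign i = 1 := by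
  simp [sign, ← mul_pow]

theorem Config.sign_insert {i k : ℤ} {S : Config} (hk : k ∉ S.1) :
    (S.insert k).sign i = if i < k then -S.sign i else S.sign i := by
  unfold sign insert
  split_ifs with h
  · have : Insert.insert k S.1 ∩ Set.Ioi i = Insert.insert k (S.1 ∩ Set.Ioi i) := by
      ext a; simp only [Set.mem_inter_iff, Set.mem_insert_iff, Set.mem_Ioi]; grind
    simp only [this]
    rw [Set.ncard_insert_of_notMem (fun h' => hk h'.1) (S.finite_inter_Ioi i), pow_succ]
    ring
  · have : Insert.insert k S.1 ∩ Set.Ioi i = S.1 ∩ Set.Ioi i := by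
      ext a; simp only [Set.mem_inter_iff, Set.mem_insert_iff, Set.mem_Ioi]; grind
    simp only [this]

theorem Config.insert_erase {k : ℤ} {S : Config} (hk : k ∈ S.1) : (S.erase k).insert k = S :=
  Subtype.ext (by simp [erase, insert, hk])

theorem Config.erase_insert {k : ℤ} {S : Config} (hk : k ∉ S.1) : (S.insert k).erase k = S :=
  Subtype.ext (by simp [erase, insert, hk])

theorem Config.mem_insert {i k : ℤ} {S : Config} : i ∈ (S.insert k).1 ↔ i = k ∨ i ∈ S.1 := Iff.rfl

theorem Config.mem_erase {i k : ℤ} {S : Config} : i ∈ (S.erase k).1 ↔ i ∈ S.1 ∧ i ≠ k := Iff.rfl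

theorem Config.sign_erase {i k : ℤ} {S : Config} (hk : k ∈ S.1) :
    (S.erase k).sign i = if i < k then -S.sign i else S.sign i := by
  have h := sign_insert (i := i) (k := k) (S := S.erase k) (by simp [mem_erase])
  rw [insert_erase hk] at h
  rw [h]
  split_ifs <;> simp

theorem Config.insert_comm (i k : ℤ) (S : Config) :
    (S.insert k).insert i = (S.insert i).insert k :=
  Subtype.ext (Set.insert_comm _ _ _)

theorem Config.erase_comm (i k : ℤ) (S : Config) : (S.erase k).erase i = (S.erase i).erase k :=
  Subtype.ext (by ext a; simp only [erase, Set.mem_sdiff]; tauto)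

theorem Config.erase_insert_comm {i k : ℤ} (h : i ≠ k) (S : Config) :
    (S.insert k).erase i = (S.erase i).insert k :=
  Subtype.ext (by
    ext a; simp only [erase, insert, Set.mem_sdiff, Set.mem_insert_iff, Set.mem_singleton_iff]
    grind)

open Classical in
/-- The creation operator `ψ_i`. -/
noncomputable def create (i : ℤ) : Module.End ℚ (Config →₀ ℚ) :=
  Finsupp.linearCombination ℚ fun S =>
    if i ∈ S.1 then 0 else S.sign i • Finsupp.single (S.insert i) 1

open Classical in
/-- The annihilation operator `ψ_i^*`. -/
noncomputable def annihilate (i : ℤ) : Module.End ℚ (Config →₀ ℚ) :=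
  Finsupp.linearCombination ℚ fun S =>
    if i ∈ S.1 then S.sign i • Finsupp.single (S.erase i) 1 else 0

open Classical in
theorem create_single (i : ℤ) (S : Config) : create i (Finsupp.single S 1) =
    if i ∈ S.1 then 0 else S.sign i • Finsupp.single (S.insert i) 1 := by
  simp [create]

open Classical in
theorem annihilate_single (i : ℤ) (S : Config) : annihilate i (Finsupp.single S 1) =
    if i ∈ S.1 then S.sign i • Finsupp.single (S.erase i) 1 else 0 := by
  simp [annihilate]

/-- Only the smaller of two distinct indices sees the other factor in its sign, so exchanging the
order costs exactly one minus sign. -/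
theorem create_mul_create (i k : ℤ) : create i * create k = -(create k * create i) := by
  refine Finsupp.lhom_ext' fun S => LinearMap.ext_ring ?_
  simp only [LinearMap.comp_apply, Finsupp.lsingle_apply, Module.End.mul_apply, LinearMap.neg_apply,
    create_single]
  by_cases hik : i = k
  · subst hik
    by_cases hi : i ∈ S.1 <;> simp [hi, create_single, Config.mem_insert, -Finsupp.smul_single]
  by_cases hi : i ∈ S.1 <;> by_cases hk : k ∈ S.1 <;>
    simp only [hi, hk, if_true, if_false, map_zero, map_smul, create_single, Config.mem_insert,
      hik, Ne.symm hik, or_true, or_false, smul_zero, neg_zero]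
  rw [Config.insert_comm i k, Config.sign_insert hi, Config.sign_insert hk, smul_smul, smul_smul,
    ← neg_smul]
  congr 1
  rcases lt_or_gt_of_ne hik with h | h
  · simp [h, h.not_gt, mul_comm]
  · simp [h, h.not_gt, mul_comm]

theorem annihilate_mul_annihilate (i k : ℤ) :
    annihilate i * annihilate k = -(annihilate k * annihilate i) := by
  refine Finsupp.lhom_ext' fun S => LinearMap.ext_ring ?_
  simp only [LinearMap.comp_apply, Finsupp.lsingle_apply, Module.End.mul_apply, LinearMap.neg_apply,
    annihilate_single]
  by_cases hik : i = k
  · subst hik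
    by_cases hi : i ∈ S.1 <;> simp [hi, annihilate_single, Config.mem_erase, -Finsupp.smul_single]
  by_cases hi : i ∈ S.1 <;> by_cases hk : k ∈ S.1 <;>
    simp only [hi, hk, if_true, if_false, map_zero, map_smul, annihilate_single, Config.mem_erase,
      hik, Ne.symm hik, ne_eq, not_false_eq_true, and_true, smul_zero, neg_zero]
  rw [Config.erase_comm i k, Config.sign_erase hi, Config.sign_erase hk, smul_smul, smul_smul,
    ← neg_smul]
  congr 1
  rcases lt_or_gt_of_ne hik with h | h
  · simp [h, h.not_gt, mul_comm]
  · simp [h, h.not_gt, mul_comm]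

theorem annihilate_mul_create (j k : ℤ) :
    annihilate j * create k = (if j = k then 1 else 0) - create k * annihilate j := by
  refine Finsupp.lhom_ext' fun S => LinearMap.ext_ring ?_
  simp only [LinearMap.comp_apply, Finsupp.lsingle_apply, Module.End.mul_apply, LinearMap.sub_apply,
    create_single, annihilate_single]
  by_cases hjk : j = k
  · subst hjk
    by_cases hi : j ∈ S.1
    · simp [hi, create_single, Config.mem_erase, Config.sign_erase, smul_smul,
        Config.sign_mul_self, Config.insert_erase, -Finsupp.smul_single]
    · simp [hi, annihilate_single, Config.mem_insert, Config.sign_insert, smul_smul,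
        Config.sign_mul_self, Config.erase_insert, -Finsupp.smul_single]
  by_cases hj : j ∈ S.1 <;> by_cases hk : k ∈ S.1 <;>
    simp only [hj, hk, hjk, if_true, if_false, map_zero, map_smul, create_single,
      annihilate_single, Config.mem_erase, Config.mem_insert, LinearMap.zero_apply,
      Ne.symm hjk, ne_eq, not_false_eq_true, and_true, smul_zero, or_true, or_false, sub_zero, zero_sub]
  rw [Config.erase_insert_comm hjk, Config.sign_insert hk, Config.sign_erase hj, smul_smul,
    smul_smul, ← neg_smul]
  congr 1
  rcases lt_or_gt_of_ne hjk with h | h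
  · simp [h, h.not_gt, mul_comm]
  · simp [h, h.not_gt, mul_comm]

/-- After moving `annihilate j` past `create k`, the remaining quartic term is the same for both
products, since swapping the creators and swapping the annihilators give two signs that cancel. -/
theorem create_annihilate_commutator (i j k l : ℤ) :
    create i * annihilate j * (create k * annihilate l) -
      create k * annihilate l * (create i * annihilate j) =
    (if j = k then create i * annihilate l else 0) -
      (if i = l then create k * annihilate j else 0) := by
  have h1 : ∀ i j k l : ℤ, create i * annihilate j * (create k * annihilate l) =
      (if j = k then create i * annihilate l else 0)
        - create i * create k * (annihilate j * annihilate l) := by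
    intro i j k l
    rw [mul_assoc, ← mul_assoc (annihilate j), annihilate_mul_create, sub_mul, mul_sub]
    split_ifs <;> simp [mul_assoc]
  have h2 : ∀ A B : Module.End ℚ (Config →₀ ℚ), -A * -B = A * B := fun A B => neg_mul_neg A B
  rw [h1, h1 k l i j, create_mul_create i k, annihilate_mul_annihilate j l, h2]
  simp only [eq_comm (a := l)]
  abel

/-! ### The operators `E_{ij}` on the charge-zero space -/

/-- A basis wedge of charge zero as a configuration. -/
def Maya.config (S : Maya) : Config := ⟨S.carrier, S.finite_pos⟩

theorem Maya.config_injective : Function.Injective Maya.config := by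
  rintro ⟨S, _, _, _⟩ ⟨T, _, _, _⟩ h
  have : S = T := congrArg Subtype.val h
  subst this
  rfl

/-- The inclusion of the charge-zero space. -/
noncomputable def Fock.incl : Fock →ₗ[ℚ] (Config →₀ ℚ) := Finsupp.lmapDomain ℚ ℚ Maya.config

theorem Fock.incl_injective : Function.Injective Fock.incl :=
  Finsupp.mapDomain_injective Maya.config_injective

/-- The operator `E_{ij}`. -/
noncomputable def matrixUnit (i j : ℤ) : Module.End ℚ Fock :=
  Finsupp.linearCombination ℚ (matrixUnitBasis i j)

theorem matrixUnit_single (i j : ℤ) (S : Maya) :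
    matrixUnit i j (Finsupp.single S 1) = matrixUnitBasis i j S := by
  simp [matrixUnit]

/-- The factors beyond both indices are counted twice and cancel, which leaves those strictly
between, as in `matrixUnitBasis`. -/
theorem Config.sign_mul_sign_erase {i j : ℤ} {S : Config} (hj : j ∈ S.1) (hi : i ∉ S.1) :
    S.sign j * (S.erase j).sign i = (-1) ^ (S.1 ∩ Set.Ioo (min i j) (max i j)).ncard := by
  have hij : i ≠ j := fun h => hi (h ▸ hj)
  have key : ∀ a b : ℤ, a < b → (S.1 ∩ Set.Ioi a).ncard =
      (S.1 ∩ Set.Ioo a b).ncard + (S.1 ∩ Set.Ici b).ncard := by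
    intro a b hab
    rw [← Set.ncard_union_eq ?_ ?_ ?_]
    · congr 1
      ext x; simp only [Set.mem_inter_iff, Set.mem_union, Set.mem_Ioo, Set.mem_Ioi, Set.mem_Ici]
      grind
    · rw [Set.disjoint_left]
      rintro x ⟨_, h1⟩ ⟨_, h2⟩
      exact absurd h1.2 (not_lt.2 h2)
    · exact (S.finite_inter_Ioi a).subset fun x hx => ⟨hx.1, hx.2.1⟩
    · exact (S.finite_inter_Ioi a).subset fun x hx => ⟨hx.1, lt_of_lt_of_le hab hx.2⟩
  rw [sign_erase hj]
  rcases lt_or_gt_of_ne hij with h | h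
  · have e : S.1 ∩ Set.Ici j = Insert.insert j (S.1 ∩ Set.Ioi j) := by
      ext x; simp only [Set.mem_inter_iff, Set.mem_insert_iff, Set.mem_Ioi, Set.mem_Ici]; grind
    have := S.sign_mul_self j
    rw [if_pos h, min_eq_left h.le, max_eq_right h.le]
    unfold sign at *
    rw [key i j h, e, Set.ncard_insert_of_notMem (fun h' => lt_irrefl j h'.2)
      (S.finite_inter_Ioi j), pow_add, pow_add]
    linear_combination ((-1) ^ (S.1 ∩ Set.Ioo i j).ncard) * this
  · have e : S.1 ∩ Set.Ici i = S.1 ∩ Set.Ioi i := by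
      ext x; simp only [Set.mem_inter_iff, Set.mem_Ioi, Set.mem_Ici]; grind
    have := S.sign_mul_self i
    rw [if_neg h.not_gt, min_eq_right h.le, max_eq_left h.le]
    unfold sign at *
    rw [key j i h, e, pow_add]
    linear_combination ((-1) ^ (S.1 ∩ Set.Ioo j i).ncard) * this

theorem incl_comp_matrixUnit (i j : ℤ) : Fock.incl ∘ₗ matrixUnit i j =
    (create i * annihilate j) ∘ₗ Fock.incl -
      (if i = j ∧ j < 0 then (1 : ℚ) else 0) • Fock.incl := by
  refine Finsupp.lhom_ext' fun S => LinearMap.ext_ring ?_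
  have hS : Fock.incl (Finsupp.single S 1) = Finsupp.single S.config 1 := by
    simp [Fock.incl]
  simp only [LinearMap.comp_apply, Finsupp.lsingle_apply, Module.End.mul_apply,
    LinearMap.sub_apply, LinearMap.smul_apply, matrixUnit_single, hS, annihilate_single]
  unfold matrixUnitBasis
  have hmem : ∀ a, a ∈ S.config.1 ↔ a ∈ S.carrier := fun a => Iff.rfl
  by_cases hij : i = j
  · subst hij
    by_cases hi : i ∈ S.carrier
    · simp only [hmem, hi, if_true, map_smul, hS, create_single, Config.mem_erase, ne_eq,
        not_true, and_false, if_false, true_and, sub_smul, one_smul,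
        Config.insert_erase ((hmem i).2 hi), smul_smul, Config.sign_erase ((hmem i).2 hi),
        lt_irrefl, Config.sign_mul_self, map_sub]
    · by_cases h : i < 0 <;> simp [hmem, hi, hS, h]
  · by_cases hj : j ∈ S.carrier
    · by_cases hi : i ∈ S.carrier
      · simp [hmem, hi, hj, hij, create_single, Config.mem_erase, -Finsupp.smul_single]
      · have hm : Fock.incl (Finsupp.single (S.move i j hj hi) 1) =
            Finsupp.single ((S.config.erase j).insert i) 1 := by
          simp only [Fock.incl, Finsupp.lmapDomain_apply, Finsupp.mapDomain_single]
          rfl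
        rw [if_neg hij, dif_pos ⟨hj, hi⟩, map_smul, hm]
        simp only [hmem, hj, if_true, map_smul, create_single, Config.mem_erase, hi, false_and,
          if_false, hij, zero_smul, sub_zero, smul_smul]
        rw [Config.sign_mul_sign_erase hj hi]
        rfl
    · simp [hmem, hj, hij]

/-- The commutation relations of the central extension of `gl_∞`. -/
theorem matrixUnit_commutator (i j k l : ℤ) :
    matrixUnit i j * matrixUnit k l - matrixUnit k l * matrixUnit i j =
      (if j = k then matrixUnit i l else 0) - (if i = l then matrixUnit k j else 0) +
      (if j = k ∧ i = l then (if i < 0 then (1 : ℚ) else 0) - (if j < 0 then 1 else 0) else 0) •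
        (1 : Module.End ℚ Fock) := by
  -- Single fermions leave the charge-zero space, so the identity is checked after inclusion. The
  -- central term comes from the normal-ordering constants of the `E_{ii}`.
  refine LinearMap.ext fun v => Fock.incl_injective ?_
  have h : ∀ i j v, Fock.incl (matrixUnit i j v) = (create i * annihilate j) (Fock.incl v) -
      (if i = j ∧ j < 0 then (1 : ℚ) else 0) • Fock.incl v := fun i j v =>
    LinearMap.congr_fun (incl_comp_matrixUnit i j) v
  have hc := LinearMap.congr_fun (create_annihilate_commutator i j k l) (Fock.incl v)
  rw [LinearMap.sub_apply, Module.End.mul_apply (create i * annihilate j),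
    Module.End.mul_apply (create k * annihilate l)] at hc
  simp only [LinearMap.sub_apply, LinearMap.add_apply, LinearMap.smul_apply, Module.End.mul_apply
    (matrixUnit _ _), map_sub, map_add, map_smul, h, Module.End.one_apply]
  have e1 : Fock.incl ((if j = k then matrixUnit i l else 0) v) =
      (if j = k then create i * annihilate l else 0) (Fock.incl v) -
      (if j = k ∧ i = l ∧ i < 0 then (1 : ℚ) else 0) • Fock.incl v := by
    by_cases h1 : j = k
    · by_cases h2 : i = l <;> simp [h1, h2, h]
    · simp [h1]
  have e2 : Fock.incl ((if i = l then matrixUnit k j else 0) v) =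
      (if i = l then create k * annihilate j else 0) (Fock.incl v) -
      (if j = k ∧ i = l ∧ j < 0 then (1 : ℚ) else 0) • Fock.incl v := by
    by_cases h1 : i = l
    · by_cases h2 : k = j
      · simp [h1, h2, h]
      · simp [h1, h2, Ne.symm h2, h]
    · simp [h1]
  rw [e1, e2]
  rw [LinearMap.sub_apply] at hc
  have e3 : (if j = k ∧ i = l then (if i < 0 then (1 : ℚ) else 0) - (if j < 0 then 1 else 0)
      else 0) = (if j = k ∧ i = l ∧ i < 0 then (1 : ℚ) else 0) -
        (if j = k ∧ i = l ∧ j < 0 then (1 : ℚ) else 0) := by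
    by_cases h1 : j = k <;> by_cases h2 : i = l <;> simp [h1, h2]
  rw [e3, eq_comm, ← sub_eq_zero] at *
  rw [← hc]
  module

/-! ### Infinite sums along a diagonal and their commutators -/

open Filter

/-- The operator `∑_a f(a) E_{a-n,a}`. -/
noncomputable def bandOp (n : ℤ) (f : ℤ → ℚ) : Module.End ℚ Fock :=
  Finsupp.linearCombination ℚ fun S : Maya => ∑ᶠ a : ℤ, f a • matrixUnitBasis (a - n) a S

theorem finite_support_matrixUnit (n : ℤ) (v : Fock) :
    (Function.support fun a : ℤ => matrixUnit (a - n) a v).Finite := by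
  induction v using Finsupp.induction_linear with
  | zero => simp
  | add v w hv hw =>
    refine (hv.union hw).subset ?_
    simp only [map_add]
    exact Function.support_add _ _
  | single S c =>
    refine (finite_support_calE n 0 S).subset ?_
    intro a ha h
    refine ha ?_
    rw [← mul_one c, ← smul_eq_mul, ← Finsupp.smul_single]
    simp only [pow_zero, Nat.factorial_zero, Nat.cast_one, div_one, one_smul] at h
    simp only [map_smul, matrixUnit_single, h, smul_zero]

theorem finite_support_smul_matrixUnit (n : ℤ) (f : ℤ → ℚ) (v : Fock) :
    (Function.support fun a : ℤ => f a • matrixUnit (a - n) a v).Finite :=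
  (finite_support_matrixUnit n v).subset fun a ha h => ha (by
    have h' : matrixUnit (a - n) a v = 0 := h
    simp only [h', smul_zero])

theorem bandOp_apply (n : ℤ) (f : ℤ → ℚ) (v : Fock) :
    bandOp n f v = ∑ᶠ a : ℤ, f a • matrixUnit (a - n) a v := by
  induction v using Finsupp.induction_linear with
  | zero => simp
  | add v w hv hw =>
    rw [map_add, hv, hw, ← finsum_add_distrib (finite_support_smul_matrixUnit n f v)
      (finite_support_smul_matrixUnit n f w)]
    simp only [map_add, smul_add]
  | single S c =>
    rw [bandOp, Finsupp.linearCombination_single, smul_finsum]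
    refine finsum_congr fun a => ?_
    rw [matrixUnit, Finsupp.linearCombination_single, smul_comm]

/-- The second condition `a - n ∈ K` is what a double sum over `K × K` leaves after contracting one
index; for large `K` it holds on the whole finite support. -/
theorem eventually_finsum_eq_sum_shift {M : Type*} [AddCommMonoid M] (φ : ℤ → M)
    (hφ : (Function.support φ).Finite) (n : ℤ) :
    ∀ᶠ K : Finset ℤ in atTop, ∑ᶠ a, φ a = ∑ a ∈ K, if a - n ∈ K then φ a else 0 := by
  classical
  filter_upwards [eventually_ge_atTop (hφ.toFinset ∪ hφ.toFinset.image (· - n))] with K hK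
  have hK1 : ∀ a, φ a ≠ 0 → a ∈ K := fun a ha => hK (Finset.mem_union_left _ (by simpa using ha))
  have hK2 : ∀ a, φ a ≠ 0 → a - n ∈ K := fun a ha => hK (Finset.mem_union_right _
    (Finset.mem_image_of_mem _ (by simpa using ha)))
  rw [finsum_eq_sum_of_support_subset (s := K) φ fun a ha => hK1 a ha]
  refine Finset.sum_congr rfl fun a _ => ?_
  split_ifs with h
  · rfl
  · by_contra h'
    exact h (hK2 a h')

theorem eventually_bandOp_apply (n : ℤ) (f : ℤ → ℚ) (v : Fock) :
    ∀ᶠ K : Finset ℤ in atTop, bandOp n f v = ∑ a ∈ K, f a • matrixUnit (a - n) a v := by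
  filter_upwards [eventually_finsum_eq_sum_shift _ (finite_support_smul_matrixUnit n f v) 0]
    with K hK
  rw [bandOp_apply, hK]
  exact Finset.sum_congr rfl fun a ha => by simp [ha]

/-- The value of the two-cocycle of the central extension. -/
noncomputable def cocycle (m : ℤ) (f g : ℤ → ℚ) : ℚ :=
  ∑ᶠ a : ℤ, f a * g (a - m) * ((if a - m < 0 then (1 : ℚ) else 0) - if a < 0 then 1 else 0)

theorem finite_support_cocycle (m : ℤ) (f g : ℤ → ℚ) : (Function.support fun a : ℤ =>
    f a * g (a - m) * ((if a - m < 0 then (1 : ℚ) else 0) - if a < 0 then 1 else 0)).Finite := by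
  refine (Set.finite_Icc (-|m|) |m|).subset fun a ha => ?_
  by_contra h
  refine ha ?_
  have h1 := le_abs_self m
  have h2 := neg_abs_le m
  have : a - m < 0 ↔ a < 0 := by
    simp only [Set.mem_Icc, not_and_or, not_le] at h
    omega
  simp [this]

theorem bandOp_sub (n : ℤ) (f g : ℤ → ℚ) (v : Fock) :
    bandOp n (fun a => f a - g a) v = bandOp n f v - bandOp n g v := by
  simp only [bandOp_apply]
  rw [← finsum_sub_distrib (finite_support_smul_matrixUnit n f v)
    (finite_support_smul_matrixUnit n g v)]
  simp only [sub_smul]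

/-- On a fixed vector all the sums involved are finite, so one large finite set `K` computes all of
them, and the claim becomes the relation `matrixUnit_commutator` summed over `K × K`. -/
theorem bandOp_commutator (m n : ℤ) (f g : ℤ → ℚ) :
    bandOp m f * bandOp n g - bandOp n g * bandOp m f =
      bandOp (m + n) (fun b => f (b - n) * g b - f b * g (b - m)) +
        (if m + n = 0 then cocycle m f g else 0) • (1 : Module.End ℚ Fock) := by
  refine LinearMap.ext fun v => ?_
  have e1 := eventually_bandOp_apply n g v
  have e2 := eventually_bandOp_apply m f v
  have e3 := eventually_bandOp_apply m f (bandOp n g v)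
  have e4 := eventually_bandOp_apply n g (bandOp m f v)
  have e5 := eventually_finsum_eq_sum_shift _
    (finite_support_smul_matrixUnit (m + n) (fun b => f (b - n) * g b) v) n
  have e6 := eventually_finsum_eq_sum_shift _
    (finite_support_smul_matrixUnit (m + n) (fun b => f b * g (b - m)) v) m
  have e7 := eventually_finsum_eq_sum_shift _ (finite_support_cocycle m f g) m
  obtain ⟨K, h1, h2, h3, h4, h5, h6, h7⟩ := (e1.and (e2.and (e3.and (e4.and
    (e5.and (e6.and e7)))))).exists
  rw [LinearMap.sub_apply, Module.End.mul_apply, Module.End.mul_apply, h3, h4, h1, h2,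
    LinearMap.add_apply, bandOp_sub, bandOp_apply, bandOp_apply, h5, h6, LinearMap.smul_apply,
    Module.End.one_apply, cocycle, h7]
  simp only [map_sum, map_smul, Finset.smul_sum, smul_smul]
  rw [Finset.sum_comm (s := K) (t := K) (f := fun b a =>
    (g b * f a) • matrixUnit (b - n) b (matrixUnit (a - m) a v)), ← Finset.sum_sub_distrib]
  have key : ∀ a ∈ K, ∑ b ∈ K, (f a * g b) • matrixUnit (a - m) a (matrixUnit (b - n) b v) -
      ∑ b ∈ K, (g b * f a) • matrixUnit (b - n) b (matrixUnit (a - m) a v) =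
      ∑ b ∈ K, (if a = b - n then (f (b - n) * g b) • matrixUnit (b - (m + n)) b v else 0) -
      (if a - m ∈ K then (f a * g (a - m)) • matrixUnit (a - (m + n)) a v else 0) +
      (if m + n = 0 then (if a - m ∈ K then f a * g (a - m) *
        ((if a - m < 0 then (1 : ℚ) else 0) - if a < 0 then 1 else 0) else 0) else 0) • v := by
    intro a _
    have hb : ∀ b, (f a * g b) • matrixUnit (a - m) a (matrixUnit (b - n) b v) -
        (g b * f a) • matrixUnit (b - n) b (matrixUnit (a - m) a v) =
        (if a = b - n then (f (b - n) * g b) • matrixUnit (b - (m + n)) b v else 0) -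
        (if a - m = b then (f a * g b) • matrixUnit (a - (m + n)) a v else 0) +
        (if a - m = b then (if m + n = 0 then (f a * g b *
        ((if a - m < 0 then (1 : ℚ) else 0) - if a < 0 then 1 else 0)) else 0) else 0) • v := by
      intro b
      have := LinearMap.congr_fun (matrixUnit_commutator (a - m) a (b - n) b) v
      rw [LinearMap.sub_apply, Module.End.mul_apply, Module.End.mul_apply] at this
      rw [mul_comm (g b), ← smul_sub, this, LinearMap.add_apply, LinearMap.sub_apply, smul_add,
        smul_sub, LinearMap.smul_apply, Module.End.one_apply, smul_smul]
      congr 1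
      · congr 1
        · split_ifs with h
          · rw [h]; congr 3; omega
          · simp
        · split_ifs with h
          · congr 3; omega
          · simp
      · congr 1
        by_cases h : a - m = b
        · have : a = b - n ↔ m + n = 0 := by omega
          by_cases h' : m + n = 0 <;> simp [h, h', this]
        · simp [h]
    rw [← Finset.sum_sub_distrib, Finset.sum_congr rfl fun b _ => hb b, Finset.sum_add_distrib,
      Finset.sum_sub_distrib, ← Finset.sum_smul, Finset.sum_ite_eq, Finset.sum_ite_eq]
    split_ifs <;> rfl
  rw [Finset.sum_congr rfl key, Finset.sum_add_distrib, Finset.sum_sub_distrib, ← Finset.sum_smul,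
    Finset.sum_comm]
  simp only [Finset.sum_ite_eq']
  congr 2
  split_ifs <;> simp

/-! ### Centred symbols and vacuum expectation values -/

/-- The operator `∑_a F(a + 1/2 - n/2) E_{a-n,a}` with (centred) symbol `F`. -/
noncomputable def symbolOp (n : ℤ) (F : ℚ → ℚ) : Module.End ℚ Fock :=
  bandOp n fun a => F ((a : ℚ) + 1 / 2 - n / 2)

/-- The symbol of a commutator. -/
def bracket (m n : ℚ) (F G : ℚ → ℚ) : ℚ → ℚ := fun c =>
  F (c - n / 2) * G (c + m / 2) - F (c + n / 2) * G (c - m / 2)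

/-- The half-integer grid sum that is the central term of a commutator. -/
def gridSum (m : ℕ) (F : ℚ → ℚ) : ℚ := ∑ a ∈ Finset.range m, F ((a : ℚ) + 1 / 2 - m / 2)

theorem bandOp_bracket (m n : ℤ) (F G : ℚ → ℚ) :
    bandOp (m + n) (fun b => F (((b - n : ℤ) : ℚ) + 1 / 2 - m / 2) * G ((b : ℚ) + 1 / 2 - n / 2) -
      F ((b : ℚ) + 1 / 2 - m / 2) * G (((b - m : ℤ) : ℚ) + 1 / 2 - n / 2)) =
      symbolOp (m + n) (bracket m n F G) := by
  unfold symbolOp bracket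
  congr 1
  funext b
  push_cast
  congr 3 <;> ring_nf

theorem symbolOp_mul (m n : ℤ) (hmn : m + n ≠ 0) (F G : ℚ → ℚ) :
    symbolOp m F * symbolOp n G =
      symbolOp n G * symbolOp m F + symbolOp (m + n) (bracket m n F G) := by
  have := bandOp_commutator m n (fun a => F ((a : ℚ) + 1 / 2 - m / 2))
    (fun a => G ((a : ℚ) + 1 / 2 - n / 2))
  rw [bandOp_bracket, if_neg hmn, zero_smul, add_zero, sub_eq_iff_eq_add'] at this
  exact this

/-- The difference of the two indicators is 1 exactly for `0 ≤ a < m` and 0 otherwise. -/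
theorem cocycle_eq_gridSum (m : ℕ) (F G : ℚ → ℚ) :
    cocycle m (fun a => F ((a : ℚ) + 1 / 2 - m / 2))
      (fun a => G ((a : ℚ) + 1 / 2 + m / 2)) = gridSum m (fun c => F c * G c) := by
  unfold cocycle gridSum
  rw [finsum_eq_sum_of_support_subset (s := (Finset.range m).image fun a : ℕ => (a : ℤ))]
  · rw [Finset.sum_image (by simp)]
    refine Finset.sum_congr rfl fun a ha => ?_
    have ha := Finset.mem_range.1 ha
    have h1 : (a : ℤ) - m < 0 := by omega
    have h2 : ¬ (a : ℤ) < 0 := by omega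
    simp only [h1, h2, if_true, if_false]
    push_cast
    rw [sub_zero, mul_one]
    congr 2
    ring
  · intro a ha
    by_contra h
    refine ha ?_
    have : a - m < 0 ↔ a < 0 := by
      simp only [Finset.coe_image, Finset.coe_range, Set.mem_image, Set.mem_Iio, not_exists,
        not_and] at h
      have := h a.toNat
      omega
    simp [this]

theorem symbolOp_mul_neg (m : ℕ) (F G : ℚ → ℚ) :
    symbolOp m F * symbolOp (-m) G =
      symbolOp (-m) G * symbolOp m F + symbolOp 0 (bracket m (-m) F G) +
        gridSum m (fun c => F c * G c) • (1 : Module.End ℚ Fock) := by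
  have := bandOp_commutator m (-m) (fun a => F ((a : ℚ) + 1 / 2 - (m : ℤ) / 2))
    (fun a => G ((a : ℚ) + 1 / 2 - (-m : ℤ) / 2))
  rw [bandOp_bracket, if_pos (add_neg_cancel _), sub_eq_iff_eq_add', add_neg_cancel] at this
  have h2 := cocycle_eq_gridSum m F G
  unfold symbolOp at *
  rw [this, ← h2, add_assoc]
  push_cast
  congr 3
  simp only [neg_div, sub_neg_eq_add]

/-- For `n > 0` every occupied place of the vacuum has an occupied target; for `n = 0` normal
ordering gives zero. -/
theorem symbolOp_vacuum (n : ℤ) (hn : 0 ≤ n) (F : ℚ → ℚ) :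
    symbolOp n F (Finsupp.single Maya.vacuum 1) = 0 := by
  rw [symbolOp, bandOp_apply]
  refine (finsum_congr fun a => ?_).trans finsum_zero
  rw [matrixUnit_single]
  have : matrixUnitBasis (a - n) a Maya.vacuum = 0 := by
    unfold matrixUnitBasis
    simp only [Maya.vacuum, Set.mem_Iio]
    split_ifs with h1 h2 h3 <;> simp_all
    omega
  rw [this, smul_zero]

theorem vev_mul_symbolOp (n : ℤ) (hn : 0 ≤ n) (F : ℚ → ℚ) (A : Module.End ℚ Fock) :
    vev (A * symbolOp n F) = 0 := by
  rw [vev, Module.End.mul_apply, symbolOp_vacuum n hn]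
  simp

/-- A move from `a` up to `a - n` cannot end in the vacuum: it would leave `a` empty below the
occupied place `a - n`. -/
theorem vev_symbolOp_mul (n : ℤ) (hn : n < 0) (F : ℚ → ℚ) (A : Module.End ℚ Fock) :
    vev (symbolOp n F * A) = 0 := by
  rw [vev, Module.End.mul_apply]
  generalize A (Finsupp.single Maya.vacuum 1) = v
  have hb : ∀ a S, matrixUnitBasis (a - n) a S Maya.vacuum = 0 := by
    intro a S
    classical
    unfold matrixUnitBasis
    rw [if_neg (by omega)]
    split_ifs with h2
    · rw [Finsupp.smul_apply, Finsupp.single_apply, if_neg, smul_zero]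
      intro h
      have h5 : (S.move (a - n) a h2.1 h2.2).carrier = Set.Iio 0 := by rw [h]; rfl
      have h6 : a - n ∈ Set.Iio (0 : ℤ) := h5 ▸ Set.mem_insert _ _
      have h7 : a ∉ Set.Iio (0 : ℤ) := by
        rw [← h5]
        rintro (h | h)
        · omega
        · exact h.2 rfl
      simp only [Set.mem_Iio] at h6 h7
      omega
    · rfl
  have hm : ∀ a, matrixUnit (a - n) a v Maya.vacuum = 0 := by
    intro a
    rw [matrixUnit, Finsupp.linearCombination_apply, Finsupp.sum_apply]
    simp [Finsupp.sum, hb]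
  obtain ⟨K, hK⟩ := (eventually_bandOp_apply n (fun a => F ((a : ℚ) + 1 / 2 - n / 2)) v).exists
  rw [symbolOp, hK, Finsupp.finsetSum_apply]
  exact Finset.sum_eq_zero fun a _ => by rw [Finsupp.smul_apply, hm, smul_zero]

theorem vev_one : vev 1 = 1 := by simp [vev]

theorem vev_add (A B : Module.End ℚ Fock) : vev (A + B) = vev A + vev B := by simp [vev]

theorem vev_smul (c : ℚ) (A : Module.End ℚ Fock) : vev (c • A) = c * vev A := by simp [vev]

theorem calE_eq_symbolOp (n : ℤ) (hn : n ≠ 0) (r : ℕ) :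
    calE n r = symbolOp n fun c => c ^ r / (r.factorial : ℚ) := by
  rw [calE, if_neg hn, zero_smul, add_zero]
  rfl

/-! ### Classes of functions with positivity -/

section Classes

open MvPolynomial

variable {σ : Type*}

/-- Evaluation of a polynomial at an integral point. -/
noncomputable def evalInt (p : σ → ℤ) : MvPolynomial σ ℚ →+* ℚ := eval fun i => (p i : ℚ)

theorem evalInt_nsmul {P : MvPolynomial σ ℚ} {d : ℕ} (hP : P.IsHomogeneous d) (t : ℕ)
    (p : σ → ℤ) : evalInt (t • p) P = (t : ℚ) ^ d * evalInt p P := by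
  unfold evalInt
  rw [eval_eq, eval_eq, Finset.mul_sum]
  refine Finset.sum_congr rfl fun m hm => ?_
  have hd : ∑ i ∈ m.support, m i = d := by
    by_contra h
    exact (mem_support_iff.1 hm) (hP.coeff_eq_zero h)
  rw [← hd, ← Finset.prod_pow_eq_pow_sum, mul_left_comm, ← Finset.prod_mul_distrib]
  congr 1
  refine Finset.prod_congr rfl fun i _ => ?_
  rw [← mul_pow]
  simp

/-- Homogeneous polynomial functions of degree `d` that are non-negative on `Ω`. -/
def PosForm (Ω : Set (σ → ℤ)) (d : ℕ) (A : (σ → ℤ) → ℚ) : Prop :=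
  (∃ P : MvPolynomial σ ℚ, P.IsHomogeneous d ∧ ∀ p, A p = evalInt p P) ∧ ∀ p ∈ Ω, 0 ≤ A p

variable {Ω : Set (σ → ℤ)}

theorem PosForm.mul {d e : ℕ} {A B : (σ → ℤ) → ℚ} (hA : PosForm Ω d A) (hB : PosForm Ω e B) :
    PosForm Ω (d + e) fun p => A p * B p := by
  obtain ⟨⟨P, hP, h1⟩, h2⟩ := hA
  obtain ⟨⟨Q, hQ, h3⟩, h4⟩ := hB
  exact ⟨⟨P * Q, hP.mul hQ, fun p => by rw [map_mul, ← h1, ← h3]⟩,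
    fun p hp => mul_nonneg (h2 p hp) (h4 p hp)⟩

theorem PosForm.const {c : ℚ} (hc : 0 ≤ c) : PosForm Ω 0 fun _ => c :=
  ⟨⟨C c, isHomogeneous_C _ _, fun p => by simp [evalInt]⟩, fun _ _ => hc⟩

theorem PosForm.apply_nsmul {d : ℕ} {A : (σ → ℤ) → ℚ} (hA : PosForm Ω d A) (t : ℕ) (p : σ → ℤ) :
    A (t • p) = (t : ℚ) ^ d * A p := by
  obtain ⟨⟨P, hP, h1⟩, _⟩ := hA
  rw [h1, h1, evalInt_nsmul hP]

/-- Symbols depending polynomially on the point and on the variable `c`: sums of monomials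
`A(p) c ^ j` of total degree `D` whose coefficients are non-negative on `Ω`. -/
inductive PosSymbol (Ω : Set (σ → ℤ)) (D : ℤ) : ((σ → ℤ) → ℚ → ℚ) → Prop
  | zero : PosSymbol Ω D fun _ _ => 0
  | add {F G : (σ → ℤ) → ℚ → ℚ} : PosSymbol Ω D F → PosSymbol Ω D G →
      PosSymbol Ω D fun p c => F p c + G p c
  | term {d : ℕ} (j : ℕ) {A : (σ → ℤ) → ℚ} : PosForm Ω d A → (d : ℤ) + j = D →
      PosSymbol Ω D fun p c => A p * c ^ j

theorem PosSymbol.mul {D E : ℤ} {F G : (σ → ℤ) → ℚ → ℚ} (hF : PosSymbol Ω D F)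
    (hG : PosSymbol Ω E G) : PosSymbol Ω (D + E) fun p c => F p c * G p c := by
  induction hF with
  | zero => simpa using PosSymbol.zero
  | add _ _ h1 h2 => simpa only [add_mul] using h1.add h2
  | @term d i A hA hD =>
    induction hG with
    | zero => simpa using PosSymbol.zero
    | add _ _ h1 h2 => simpa only [mul_add] using h1.add h2
    | @term e j B hB hE =>
      convert PosSymbol.term (i + j) (hA.mul hB) (D := D + E) (by push_cast; omega) using 3
      ring

theorem PosSymbol.of_form {d : ℕ} {A : (σ → ℤ) → ℚ} (hA : PosForm Ω d A) :
    PosSymbol Ω d fun p _ => A p := by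
  simpa using PosSymbol.term 0 hA (D := d) (by simp)

theorem PosSymbol.var_pow (j : ℕ) : PosSymbol Ω j fun _ c => c ^ j := by
  simpa using PosSymbol.term j (PosForm.const (Ω := Ω) zero_le_one) (D := j) (by simp)

theorem PosSymbol.congr_degree {D E : ℤ} {F : (σ → ℤ) → ℚ → ℚ} (hF : PosSymbol Ω D F)
    (h : D = E) : PosSymbol Ω E F := h ▸ hF

/-- Even and odd part of a shifted symbol. -/
theorem PosSymbol.shift {D : ℤ} {F : (σ → ℤ) → ℚ → ℚ} (hF : PosSymbol Ω D F)
    {α : (σ → ℤ) → ℚ} (hα : PosForm Ω 1 α) :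
    ∃ F₀ F₁ : (σ → ℤ) → ℚ → ℚ, PosSymbol Ω D F₀ ∧ PosSymbol Ω (D - 1) F₁ ∧ ∀ p c,
      F p (c + α p) = F₀ p c + α p * F₁ p c ∧ F p (c - α p) = F₀ p c - α p * F₁ p c := by
  induction hF with
  | zero => exact ⟨_, _, .zero, .zero, by simp⟩
  | add _ _ h1 h2 =>
    obtain ⟨F₀, F₁, hF₀, hF₁, h1⟩ := h1
    obtain ⟨G₀, G₁, hG₀, hG₁, h2⟩ := h2
    refine ⟨_, _, hF₀.add hG₀, hF₁.add hG₁, fun p c => ?_⟩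
    beta_reduce
    rw [(h1 p c).1, (h2 p c).1, (h1 p c).2, (h2 p c).2]
    constructor <;> ring
  | @term d j A hA hD =>
    suffices h : ∃ F₀ F₁ : (σ → ℤ) → ℚ → ℚ, PosSymbol Ω j F₀ ∧ PosSymbol Ω (j - 1) F₁ ∧ ∀ p c,
        (c + α p) ^ j = F₀ p c + α p * F₁ p c ∧ (c - α p) ^ j = F₀ p c - α p * F₁ p c by
      obtain ⟨F₀, F₁, hF₀, hF₁, h⟩ := h
      refine ⟨_, _, ((PosSymbol.of_form hA).mul hF₀).congr_degree hD,
        ((PosSymbol.of_form hA).mul hF₁).congr_degree (by omega), fun p c => ?_⟩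
      beta_reduce
      rw [(h p c).1, (h p c).2]
      constructor <;> ring
    clear hD
    induction j with
    | zero =>
      exact ⟨_, _, by simpa using PosSymbol.var_pow (Ω := Ω) 0, .zero, by simp⟩
    | succ j ih =>
      obtain ⟨F₀, F₁, hF₀, hF₁, h⟩ := ih
      have hX := PosSymbol.var_pow (Ω := Ω) 1
      -- Multiplying by `c ± α` sends `(F₀, F₁)` to `(c F₀ + α² F₁, F₀ + c F₁)`; no minus sign
      -- enters, so non-negativity survives.
      have hα2 := PosSymbol.of_form (hα.mul hα)
      refine ⟨_, _, ((hX.mul hF₀).congr_degree (E := (j + 1 : ℕ)) (by push_cast; ring)).add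
        ((hα2.mul hF₁).congr_degree (by push_cast; ring)),
        (hF₀.congr_degree (E := (j + 1 : ℕ) - 1) (by push_cast; ring)).add
        ((hX.mul hF₁).congr_degree (by push_cast; ring)), fun p c => ?_⟩
      rw [pow_succ (c + α p), pow_succ (c - α p), (h p c).1, (h p c).2]
      constructor <;> ring

/-- Polynomial functions of degree at most `E` that are non-negative on `Ω` and, on each ray on
which they do not vanish at the first point, grow with exponent `E`. -/
def SharpPoly (Ω : Set (σ → ℤ)) (E : ℤ) (f : (σ → ℤ) → ℚ) : Prop :=
  (∃ P : MvPolynomial σ ℚ, (∀ m, P.coeff m ≠ 0 → (m.degree : ℤ) ≤ E) ∧ ∀ p, f p = evalInt p P) ∧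
  (∀ p ∈ Ω, 0 ≤ f p) ∧
  ∀ p ∈ Ω, f p ≠ 0 → ∃ ε : ℚ, 0 < ε ∧ ∀ t : ℕ, 1 ≤ t → ε * (t : ℚ) ^ E ≤ f (t • p)

theorem SharpPoly.zero (E : ℤ) : SharpPoly Ω E fun _ => 0 :=
  ⟨⟨0, by simp, by simp⟩, by simp, by simp⟩

/-- Both summands are non-negative on the whole ray, so the growth of either one is a lower bound
for the sum. -/
theorem SharpPoly.add (hΩ : ∀ p ∈ Ω, ∀ t : ℕ, 1 ≤ t → t • p ∈ Ω) {E : ℤ} {f g : (σ → ℤ) → ℚ}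
    (hf : SharpPoly Ω E f) (hg : SharpPoly Ω E g) : SharpPoly Ω E fun p => f p + g p := by
  obtain ⟨⟨P, hP, h1⟩, h2, h3⟩ := hf
  obtain ⟨⟨Q, hQ, h4⟩, h5, h6⟩ := hg
  refine ⟨⟨P + Q, fun m hm => ?_, fun p => by rw [map_add, ← h1, ← h4]⟩,
    fun p hp => add_nonneg (h2 p hp) (h5 p hp), fun p hp hfg => ?_⟩
  · by_cases hm1 : P.coeff m = 0
    · exact hQ m fun hm2 => hm (by rw [coeff_add, hm1, hm2, add_zero])
    · exact hP m hm1
  · by_cases hfp : f p = 0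
    · obtain ⟨ε, hε, h⟩ := h6 p hp fun hgp => hfg (by simp only [hfp, hgp, add_zero])
      exact ⟨ε, hε, fun t ht => (h t ht).trans (le_add_of_nonneg_left (h2 _ (hΩ p hp t ht)))⟩
    · obtain ⟨ε, hε, h⟩ := h3 p hp hfp
      exact ⟨ε, hε, fun t ht => (h t ht).trans (le_add_of_nonneg_right (h5 _ (hΩ p hp t ht)))⟩

theorem SharpPoly.form_mul {E : ℤ} {d : ℕ} {f α : (σ → ℤ) → ℚ}
    (hα : PosForm Ω d α) (hf : SharpPoly Ω E f) : SharpPoly Ω (E + d) fun p => α p * f p := by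
  classical
  have hn := hα.apply_nsmul
  obtain ⟨⟨P, hP, h1⟩, h2⟩ := hα
  obtain ⟨⟨Q, hQ, h4⟩, h5, h6⟩ := hf
  refine ⟨⟨P * Q, fun m hm => ?_, fun p => by rw [map_mul, ← h1, ← h4]⟩,
    fun p hp => mul_nonneg (h2 p hp) (h5 p hp), fun p hp hfg => ?_⟩
  · obtain ⟨a, ha, b, hb, rfl⟩ := Finset.mem_add.1 (support_mul P Q (mem_support_iff.2 hm))
    have ha' : a.degree = d := by
      by_contra h
      exact (mem_support_iff.1 ha) (hP.coeff_eq_zero h)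
    have := hQ b (mem_support_iff.1 hb)
    rw [map_add]
    push_cast
    omega
  · obtain ⟨ε, hε, h⟩ := h6 p hp (right_ne_zero_of_mul hfg)
    have hα0 : 0 < α p := lt_of_le_of_ne (h2 p hp) (left_ne_zero_of_mul hfg).symm
    refine ⟨α p * ε, by positivity, fun t ht => ?_⟩
    have ht0 : (0 : ℚ) < t := by exact_mod_cast ht
    beta_reduce
    rw [hn, zpow_add₀ ht0.ne', zpow_natCast]
    calc α p * ε * ((t : ℚ) ^ E * (t : ℚ) ^ d) = (t : ℚ) ^ d * α p * (ε * (t : ℚ) ^ E) := by ring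
      _ ≤ _ := mul_le_mul_of_nonneg_left (h t ht) (by positivity)

theorem SharpPoly.congr_degree {D E : ℤ} {f : (σ → ℤ) → ℚ} (hf : SharpPoly Ω D f)
    (h : D = E) : SharpPoly Ω E f := h ▸ hf

end Classes

/-! ### Centred power sums -/

section Grid

-- Expand the centred power binomially and apply Faulhaber's formula, in which every power of `m` is
-- at least one, so that a factor `m` splits off.
open Polynomial in
theorem exists_poly_gridSum (j : ℕ) : ∃ B : ℚ[X], B.natDegree ≤ j ∧
    ∀ m : ℕ, gridSum m (fun c => c ^ j) = m * B.eval (m : ℚ) := by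
  have hp : ∀ i : ℕ, ∃ B : ℚ[X], B.natDegree ≤ i ∧
      ∀ m : ℕ, ∑ a ∈ Finset.range m, (a : ℚ) ^ i = m * B.eval (m : ℚ) := by
    intro i
    refine ⟨∑ k ∈ Finset.range (i + 1),
      Polynomial.C (_root_.bernoulli k * (i + 1).choose k / (i + 1)) * Polynomial.X ^ (i - k),
      natDegree_sum_le_of_forall_le _ _ fun k _ =>
        (natDegree_C_mul_X_pow_le _ _).trans (Nat.sub_le _ _), fun m => ?_⟩
    rw [sum_range_pow, eval_finsetSum, Finset.mul_sum]
    refine Finset.sum_congr rfl fun k hk => ?_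
    have : i + 1 - k = (i - k) + 1 := by have := Finset.mem_range.1 hk; omega
    rw [this, pow_succ]
    simp only [eval_mul, Polynomial.eval_C, eval_pow, Polynomial.eval_X]
    ring
  choose B hB1 hB2 using hp
  refine ⟨∑ i ∈ Finset.range (j + 1), B i *
    (Polynomial.C (1 / 2) - Polynomial.C (1 / 2) * Polynomial.X) ^ (j - i) *
      Polynomial.C (j.choose i : ℚ), ?_, fun m => ?_⟩
  · refine natDegree_sum_le_of_forall_le _ _ fun i hi => ?_
    have hi : i ≤ j := by have := Finset.mem_range.1 hi; omega
    have h1 : (Polynomial.C (1 / 2 : ℚ) - Polynomial.C (1 / 2) * Polynomial.X).natDegree ≤ 1 := by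
      compute_degree
    refine (natDegree_mul_C_le _ _).trans (natDegree_mul_le.trans ?_)
    have h2 := natDegree_pow_le_of_le (j - i) h1
    have h3 := hB1 i
    omega
  · rw [eval_finsetSum, Finset.mul_sum, gridSum]
    have : ∀ a : ℕ, ((a : ℚ) + 1 / 2 - m / 2) ^ j = ∑ i ∈ Finset.range (j + 1),
        (a : ℚ) ^ i * (1 / 2 - m / 2) ^ (j - i) * (j.choose i : ℚ) := by
      intro a
      rw [add_sub_assoc, add_pow]
    rw [Finset.sum_congr rfl fun a _ => this a, Finset.sum_comm]
    refine Finset.sum_congr rfl fun i _ => ?_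
    rw [← Finset.sum_mul, ← Finset.sum_mul, hB2]
    simp only [eval_mul, Polynomial.eval_C, eval_pow, Polynomial.eval_X, eval_sub]
    ring

theorem gridSum_odd {j : ℕ} (hj : Odd j) (m : ℕ) : gridSum m (fun c => c ^ j) = 0 := by
  have h : gridSum m (fun c => c ^ j) = -gridSum m (fun c => c ^ j) := by
    unfold gridSum
    -- The grid is symmetric about 0.
    conv_lhs => rw [← Finset.sum_range_reflect]
    rw [← Finset.sum_neg_distrib]
    refine Finset.sum_congr rfl fun a ha => ?_
    have ha := Finset.mem_range.1 ha
    rw [← hj.neg_pow, Nat.cast_sub (by omega), Nat.cast_sub (by omega)]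
    congr 1
    push_cast
    ring
  linarith

theorem gridSum_nonneg (j m : ℕ) : 0 ≤ gridSum m (fun c => c ^ j) := by
  rcases Nat.even_or_odd j with h | h
  · exact Finset.sum_nonneg fun a _ => h.pow_nonneg _
  · exact (gridSum_odd h m).ge

theorem gridSum_sq (m : ℕ) : gridSum m (fun c => c ^ 2) = m * ((m : ℚ) ^ 2 - 1) / 12 := by
  have h1 : ∀ m : ℕ, ∑ a ∈ Finset.range m, (a : ℚ) = m * (m - 1) / 2 := by
    intro m
    induction m with
    | zero => simp
    | succ m ih => rw [Finset.sum_range_succ, ih]; push_cast; ring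
  have h2 : ∀ m : ℕ, ∑ a ∈ Finset.range m, (a : ℚ) ^ 2 = m * (m - 1) * (2 * m - 1) / 6 := by
    intro m
    induction m with
    | zero => simp
    | succ m ih => rw [Finset.sum_range_succ, ih]; push_cast; ring
  have h3 : ∀ a : ℕ, ((a : ℚ) + 1 / 2 - m / 2) ^ 2 =
      (a : ℚ) ^ 2 + a * (1 - m) + (1 / 2 - m / 2 : ℚ) ^ 2 := fun a => by ring
  unfold gridSum
  rw [Finset.sum_congr rfl fun a _ => h3 a, Finset.sum_add_distrib, Finset.sum_add_distrib,
    ← Finset.sum_mul, h1, h2]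
  simp only [Finset.sum_const, Finset.card_range, nsmul_eq_mul]
  ring

/-- The power mean inequality bounds higher even moments below by the second moment, which is known
exactly. -/
theorem gridSum_even_ge (i m : ℕ) (hm : 2 ≤ m) :
    (m : ℚ) ^ (2 * i + 1) * (1 / 16) ^ i ≤ gridSum m (fun c => c ^ (2 * i)) := by
  have hm' : (2 : ℚ) ≤ m := by exact_mod_cast hm
  rcases i with _ | i
  · simp [gridSum]
  have h := pow_sum_div_card_le_sum_pow (s := Finset.range m)
    (f := fun a : ℕ => ((a : ℚ) + 1 / 2 - m / 2) ^ 2) (fun _ _ => sq_nonneg _) i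
  have h2 := gridSum_sq m
  unfold gridSum at *
  rw [h2, Finset.card_range] at h
  simp only [← pow_mul] at h
  refine le_trans ?_ h
  rw [le_div_iff₀ (by positivity)]
  -- For `m ≥ 2` one has `m² - 1 ≥ 3 m² / 4`; this is where `1 / 16` comes from.
  have h3 : (m : ℚ) ^ 3 * (1 / 16) ≤ m * ((m : ℚ) ^ 2 - 1) / 12 := by nlinarith
  calc (m : ℚ) ^ (2 * (i + 1) + 1) * (1 / 16) ^ (i + 1) * (m : ℚ) ^ i
      = ((m : ℚ) ^ 3 * (1 / 16)) ^ (i + 1) := by ring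
    _ ≤ _ := pow_le_pow_left₀ (by positivity) h3 _

theorem exists_gridSum_growth {j m : ℕ} (h : gridSum m (fun c => c ^ j) ≠ 0) :
    ∃ ε : ℚ, 0 < ε ∧ ∀ t : ℕ, 1 ≤ t →
      ε * (t : ℚ) ^ (j + 1) ≤ gridSum (t * m) (fun c => c ^ j) := by
  have hm0 : 0 < m := by
    rcases Nat.eq_zero_or_pos m with rfl | h'
    · simp [gridSum] at h
    · exact h'
  rcases Nat.even_or_odd' j with ⟨i, rfl | rfl⟩
  · rcases Nat.eq_zero_or_pos i with rfl | hi
    · refine ⟨1, one_pos, fun t _ => ?_⟩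
      have : (1 : ℚ) ≤ m := by exact_mod_cast hm0
      simpa [gridSum] using le_mul_of_one_le_right (Nat.cast_nonneg (α := ℚ) t) this
    -- For `m = 1` the only grid point is 0, and its positive powers vanish.
    · have hm2 : 2 ≤ m := by
        by_contra hlt
        have : m = 1 := by omega
        subst this
        refine h ?_
        simp [gridSum, hi.ne']
      refine ⟨(m : ℚ) ^ (2 * i + 1) * (1 / 16) ^ i, by positivity, fun t ht => ?_⟩
      refine le_trans (le_of_eq ?_) (gridSum_even_ge i (t * m) (by nlinarith))
      push_cast
      ring
  · exact absurd (gridSum_odd (by simp) m) h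

theorem gridSum_add (m : ℕ) (F G : ℚ → ℚ) :
    gridSum m (fun c => F c + G c) = gridSum m F + gridSum m G := Finset.sum_add_distrib

theorem gridSum_mul_left (m : ℕ) (a : ℚ) (F : ℚ → ℚ) :
    gridSum m (fun c => a * F c) = a * gridSum m F := by simp [gridSum, Finset.mul_sum]

variable {σ : Type*} {Ω : Set (σ → ℤ)}

-- Only the monomials `c ^ j` need work: the Faulhaber quotient has degree at most `j` in `μ`, and
-- the growth `t ^ (j + 1)` of the power sum becomes `t ^ j` after division by `t * m`.
open Polynomial in
theorem PosSymbol.gridSum (hΩ : ∀ p ∈ Ω, ∀ t : ℕ, 1 ≤ t → t • p ∈ Ω) {D : ℤ}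
    {F : (σ → ℤ) → ℚ → ℚ} (hF : PosSymbol Ω D F) {μ : (σ → ℤ) → ℚ} (hμ : PosForm Ω 1 μ)
    (hμ1 : ∀ p ∈ Ω, ∃ m : ℕ, 0 < m ∧ μ p = m) :
    ∃ f, SharpPoly Ω D f ∧ ∀ p ∈ Ω, ∀ m : ℕ, μ p = m →
      LeakyHurwitz.gridSum m (F p) = m * f p := by
  induction hF with
  | zero => exact ⟨_, .zero D, by simp [LeakyHurwitz.gridSum]⟩
  | add _ _ h1 h2 =>
    obtain ⟨f, hf, h1⟩ := h1
    obtain ⟨g, hg, h2⟩ := h2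
    refine ⟨_, hf.add hΩ hg, fun p hp m hm => ?_⟩
    rw [gridSum_add, h1 p hp m hm, h2 p hp m hm, mul_add]
  | @term d j A hA hD =>
    obtain ⟨B, hB1, hB2⟩ := exists_poly_gridSum j
    suffices h : SharpPoly Ω j fun p => B.eval (μ p) by
      refine ⟨_, (h.form_mul hA).congr_degree (by omega), fun p hp m hm => ?_⟩
      rw [gridSum_mul_left, hB2, ← hm]
      ring
    have hn := hμ.apply_nsmul
    obtain ⟨⟨P, hP, h1⟩, h2⟩ := hμ
    refine ⟨⟨∑ i ∈ Finset.range (j + 1), MvPolynomial.C (B.coeff i) * P ^ i, fun m hm => ?_,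
      fun p => ?_⟩, fun p hp => ?_, fun p hp hfp => ?_⟩
    · rw [MvPolynomial.coeff_sum] at hm
      obtain ⟨i, hi, h⟩ := Finset.exists_ne_zero_of_sum_ne_zero hm
      have hh := (hP.pow i).C_mul (B.coeff i)
      have hd : m.degree = 1 * i := by
        by_contra h'
        exact h (hh.coeff_eq_zero h')
      have := Finset.mem_range.1 hi
      omega
    · beta_reduce
      rw [eval_eq_sum_range' (Nat.lt_succ_of_le hB1), map_sum]
      refine Finset.sum_congr rfl fun i _ => ?_
      rw [map_mul, map_pow, ← h1]
      simp [evalInt]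
    · obtain ⟨m, hm, hm'⟩ := hμ1 p hp
      have := gridSum_nonneg j m
      rw [hB2, ← hm'] at this
      have h0 : 0 < μ p := by rw [hm']; exact_mod_cast hm
      exact nonneg_of_mul_nonneg_right this h0
    · obtain ⟨m, hm, hm'⟩ := hμ1 p hp
      have h0 : 0 < μ p := by rw [hm']; exact_mod_cast hm
      obtain ⟨ε, hε, h⟩ := exists_gridSum_growth (j := j) (m := m)
        (by rw [hB2, ← hm']; exact mul_ne_zero h0.ne' hfp)
      refine ⟨ε / μ p, by positivity, fun t ht => ?_⟩
      have ht0 : (0 : ℚ) < t := by exact_mod_cast ht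
      have := h t ht
      rw [hB2] at this
      beta_reduce
      rw [hn, pow_one, zpow_natCast, div_mul_eq_mul_div, div_le_iff₀ h0]
      push_cast at this
      rw [← hm'] at this
      refine le_of_mul_le_mul_left ?_ ht0
      calc _ = ε * (t : ℚ) ^ (j + 1) := by ring
        _ ≤ _ := this
        _ = _ := by ring

end Grid

/-! ### Evaluation of correlators by commutation -/

section Evaluation

variable {σ : Type*}

/-- The total energy of a set of indices, where `w` contains the signs of the coordinates. -/
def energy (w : σ → ℤ) (S : Finset σ) (p : σ → ℤ) : ℤ := ∑ i ∈ S, w i * p i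

theorem energy_union [DecidableEq σ] {w : σ → ℤ} {S T : Finset σ} (h : Disjoint S T) (p : σ → ℤ) :
    energy w (S ∪ T) p = energy w S p + energy w T p := Finset.sum_union h

theorem posForm_energy {Ω : Set (σ → ℤ)} (w : σ → ℤ) (S : Finset σ) (a : ℚ)
    (h : ∀ p ∈ Ω, 0 ≤ a * (energy w S p : ℚ)) :
    PosForm Ω 1 fun p => a * (energy w S p : ℚ) := by
  refine ⟨⟨MvPolynomial.C a * ∑ i ∈ S, MvPolynomial.C (w i : ℚ) * MvPolynomial.X i,
    MvPolynomial.IsHomogeneous.C_mul (MvPolynomial.IsHomogeneous.sum _ _ _ fun i _ =>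
      MvPolynomial.isHomogeneous_C_mul_X _ _) _, fun p => ?_⟩, h⟩
  simp [energy, evalInt]

/-- A set of integral points on which the energies of all proper non-empty sets of indices have
constant non-zero sign. -/
structure IsChamberLike [Fintype σ] (w : σ → ℤ) (Ω : Set (σ → ℤ)) : Prop where
  nsmul_mem : ∀ p ∈ Ω, ∀ t : ℕ, 1 ≤ t → t • p ∈ Ω
  energy_univ : ∀ p ∈ Ω, energy w Finset.univ p = 0
  sign : ∀ S : Finset σ, S.Nonempty → S ≠ Finset.univ →
    (∀ p ∈ Ω, 0 < energy w S p) ∨ ∀ p ∈ Ω, energy w S p < 0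

/-- The operators that occur in the evaluation of a correlator: Heisenberg operators attached to a
coordinate, and operators with a symbol of degree `D` attached to a set of coordinates. -/
inductive Entry (σ : Type*)
  | current (i : σ)
  | composite (S : Finset σ) (D : ℤ) (F : (σ → ℤ) → ℚ → ℚ)

namespace Entry

def label : Entry σ → Finset σ
  | current i => {i}
  | composite S _ _ => S

def symbol : Entry σ → (σ → ℤ) → ℚ → ℚ
  | current _ => fun _ _ => 1
  | composite _ _ F => F

def degree : Entry σ → ℤ
  | current _ => -1
  | composite _ D _ => D

def weight (w : σ → ℤ) : Entry σ → (σ → ℤ) → ℚ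
  | current i => fun p => |(energy w {i} p : ℚ)|
  | composite _ _ _ => fun _ => 1

def IsValid (Ω : Set (σ → ℤ)) : Entry σ → Prop
  | current _ => True
  | composite _ D F => PosSymbol Ω D F

def IsComposite : Entry σ → Prop
  | current _ => False
  | composite _ _ _ => True

noncomputable def op (w : σ → ℤ) (A : Entry σ) (p : σ → ℤ) : Module.End ℚ Fock :=
  symbolOp (energy w A.label p) (A.symbol p)

end Entry

variable {w : σ → ℤ} {Ω : Set (σ → ℤ)}

/-- Commuting an operator of positive energy past one of negative energy. -/
theorem exists_commutator [DecidableEq σ] {A B : Entry σ} (hA : A.IsValid Ω) (hB : B.IsValid Ω)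
    (hA0 : ∀ p ∈ Ω, 0 < energy w A.label p) (hB0 : ∀ p ∈ Ω, energy w B.label p < 0) :
    ∃ F, PosSymbol Ω (A.degree + B.degree) F ∧ ∀ p ∈ Ω,
      bracket (energy w A.label p) (energy w B.label p) (A.symbol p) (B.symbol p) =
        fun c => A.weight w p * B.weight w p * F p c := by
  have hα : PosForm Ω 1 fun p => 1 / 2 * (energy w A.label p : ℚ) :=
    posForm_energy w _ _ fun p hp => by
      have : (0 : ℚ) < energy w A.label p := by exact_mod_cast hA0 p hp
      positivity
  have hβ : PosForm Ω 1 fun p => -1 / 2 * (energy w B.label p : ℚ) :=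
    posForm_energy w _ _ fun p hp => by
      have : (energy w B.label p : ℚ) < 0 := by exact_mod_cast hB0 p hp
      linarith
  have e1 : ∀ (p : σ → ℤ) (c : ℚ), c + (energy w A.label p : ℚ) / 2 =
      c + 1 / 2 * energy w A.label p := fun p c => by ring
  have e2 : ∀ (p : σ → ℤ) (c : ℚ), c - (energy w A.label p : ℚ) / 2 =
      c - 1 / 2 * energy w A.label p := fun p c => by ring
  have e3 : ∀ (p : σ → ℤ) (c : ℚ), c + (energy w B.label p : ℚ) / 2 =
      c - -1 / 2 * energy w B.label p := fun p c => by ring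
  have e4 : ∀ (p : σ → ℤ) (c : ℚ), c - (energy w B.label p : ℚ) / 2 =
      c + -1 / 2 * energy w B.label p := fun p c => by ring
  unfold bracket
  simp only [e1, e2, e3, e4]
  match A, B with
  | .current i, .current j =>
    -- Both symbols are constant, so the bracket vanishes.
    exact ⟨_, .zero, fun p _ => by simp [Entry.symbol]⟩
  | .current i, .composite S D G =>
    obtain ⟨G₀, G₁, hG₀, hG₁, h⟩ := PosSymbol.shift hB hα
    -- The even parts cancel in `G(c + α) - G(c - α) = 2 α G₁`, and `2 α` is the weight of the
    -- current.
    refine ⟨G₁, hG₁.congr_degree (by simp [Entry.degree]; ring), fun p hp => funext fun c => ?_⟩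
    have hw : |(energy w {i} p : ℚ)| = energy w {i} p :=
      abs_of_pos (by exact_mod_cast hA0 p hp)
    simp only [Entry.symbol, Entry.weight, hw, (h p c).1, (h p c).2]
    simp only [Entry.label]
    ring
  | .composite S D F, .current j =>
    obtain ⟨F₀, F₁, hF₀, hF₁, h⟩ := PosSymbol.shift hA hβ
    refine ⟨F₁, hF₁.congr_degree (by simp [Entry.degree]; ring), fun p hp => funext fun c => ?_⟩
    have hw : |(energy w {j} p : ℚ)| = -energy w {j} p :=
      abs_of_neg (by exact_mod_cast hB0 p hp)
    simp only [Entry.symbol, Entry.weight, hw, (h p c).1, (h p c).2]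
    simp only [Entry.label]
    ring
  | .composite S D F, .composite T E G =>
    obtain ⟨F₀, F₁, hF₀, hF₁, hF⟩ := PosSymbol.shift hA hβ
    obtain ⟨G₀, G₁, hG₀, hG₁, hG⟩ := PosSymbol.shift hB hα
    -- The bracket equals `2 (α F₀ G₁ + β F₁ G₀)`, where `α` and `β` are half the absolute energies.
    -- Here no weight is split off, and the factors `α`, `β` restore the degree lost by the odd
    -- parts.
    have h2 := PosSymbol.of_form (PosForm.const (Ω := Ω) (zero_le_two (α := ℚ)))
    refine ⟨_, (h2.mul (((PosSymbol.of_form hα).mul (hF₀.mul hG₁)).congr_degree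
      (E := D + E) (by push_cast; ring) |>.add
      (((PosSymbol.of_form hβ).mul (hF₁.mul hG₀)).congr_degree (by push_cast; ring)))).congr_degree
      (by simp [Entry.degree]), fun p hp => funext fun c => ?_⟩
    simp only [Entry.symbol, Entry.weight, (hF p c).1, (hF p c).2, (hG p c).1, (hG p c).2]
    ring

theorem symbolOp_mul_left (n : ℤ) (a : ℚ) (F : ℚ → ℚ) :
    symbolOp n (fun c => a * F c) = a • symbolOp n F := by
  refine LinearMap.ext fun v => ?_
  simp only [symbolOp, LinearMap.smul_apply, bandOp_apply, smul_finsum, mul_smul]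

/-- Lists of operators whose labels form a partition of the set of all indices. -/
structure IsAdmissible (Ω : Set (σ → ℤ)) (L : List (Entry σ)) : Prop where
  nonempty : ∀ A ∈ L, A.label.Nonempty
  valid : ∀ A ∈ L, A.IsValid Ω
  pairwise : L.Pairwise fun A B => Disjoint A.label B.label
  cover : ∀ i, ∃ A ∈ L, i ∈ A.label
  composite : ∃ A ∈ L, A.IsComposite
  two_le : 2 ≤ L.length

theorem IsAdmissible.perm {L L' : List (Entry σ)} (h : IsAdmissible Ω L) (hp : L.Perm L') :
    IsAdmissible Ω L' where
  nonempty A hA := h.nonempty A (hp.mem_iff.2 hA)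
  valid A hA := h.valid A (hp.mem_iff.2 hA)
  pairwise := (hp.pairwise_iff fun h => h.symm).1 h.pairwise
  cover i := by simpa only [hp.mem_iff] using h.cover i
  composite := by simpa only [hp.mem_iff] using h.composite
  two_le := hp.length_eq ▸ h.two_le

/-- A non-empty rest keeps the list at length two or more, so the merged label is still a proper set
and its energy has a sign. -/
theorem IsAdmissible.merge [DecidableEq σ] {A B : Entry σ} {l : List (Entry σ)} {D : ℤ}
    {F : (σ → ℤ) → ℚ → ℚ} (h : IsAdmissible Ω (A :: B :: l)) (hF : PosSymbol Ω D F)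
    (hl : l ≠ []) : IsAdmissible Ω (.composite (A.label ∪ B.label) D F :: l) where
  nonempty C hC := by
    rcases List.mem_cons.1 hC with rfl | hC
    · exact (h.nonempty A (by simp)).mono Finset.subset_union_left
    · exact h.nonempty C (by simp [hC])
  valid C hC := by
    rcases List.mem_cons.1 hC with rfl | hC
    · exact hF
    · exact h.valid C (by simp [hC])
  pairwise := by
    have := h.pairwise
    simp only [List.pairwise_cons, List.mem_cons, forall_eq_or_imp] at this ⊢
    exact ⟨fun C hC => Finset.disjoint_union_left.2 ⟨this.1.2 C hC, this.2.1 C hC⟩, this.2.2⟩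
  cover i := by
    obtain ⟨C, hC, hi⟩ := h.cover i
    simp only [List.mem_cons] at hC
    rcases hC with rfl | rfl | hC
    · exact ⟨_, List.mem_cons_self, Finset.mem_union_left _ hi⟩
    · exact ⟨_, List.mem_cons_self, Finset.mem_union_right _ hi⟩
    · exact ⟨C, List.mem_cons_of_mem _ hC, hi⟩
  composite := ⟨_, List.mem_cons_self, trivial⟩
  two_le := by
    have := List.length_pos_of_ne_nil hl
    simp only [List.length_cons]
    omega

theorem IsAdmissible.label_ne_univ [Fintype σ] {A : Entry σ} {l : List (Entry σ)}
    (h : IsAdmissible Ω (A :: l)) : A.label ≠ Finset.univ := by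
  intro hA
  have h2 := h.two_le
  rcases l with _ | ⟨B, l⟩
  · simp at h2
  · obtain ⟨i, hi⟩ := h.nonempty B (by simp)
    have hd := (List.pairwise_cons.1 h.pairwise).1 B (by simp)
    rw [hA] at hd
    exact Finset.disjoint_left.1 hd (Finset.mem_univ i) hi

theorem IsAdmissible.sign [Fintype σ] (hΩ : IsChamberLike w Ω) {A : Entry σ} {L : List (Entry σ)}
    (h : IsAdmissible Ω L) (hA : A ∈ L) :
    (∀ p ∈ Ω, 0 < energy w A.label p) ∨ ∀ p ∈ Ω, energy w A.label p < 0 := by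
  classical
  obtain ⟨l₁, l₂, rfl⟩ := List.append_of_mem hA
  exact hΩ.sign _ (h.nonempty A hA) (h.perm List.perm_middle).label_ne_univ

/-- The vacuum expectation value of a list of operators. -/
noncomputable def correlator (w : σ → ℤ) (L : List (Entry σ)) (p : σ → ℤ) : ℚ :=
  vev (L.map fun A => A.op w p).prod

/-- The evaluation of a correlator as a product of weights and a sharp polynomial. -/
def IsEvaluated (w : σ → ℤ) (Ω : Set (σ → ℤ)) (L : List (Entry σ)) : Prop :=
  ∃ f, SharpPoly Ω ((L.map Entry.degree).sum + 1) f ∧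
    ∀ p ∈ Ω, correlator w L p = (L.map fun A => A.weight w p).prod * f p

theorem isEvaluated_of_eq_zero {L : List (Entry σ)} (h : ∀ p ∈ Ω, correlator w L p = 0) :
    IsEvaluated w Ω L :=
  ⟨_, .zero _, fun p hp => by rw [h p hp, mul_zero]⟩

variable [Fintype σ] [DecidableEq σ]

/-- The two labels are complementary, so the energies are opposite and only the central term of the
commutator survives in the vacuum expectation. -/
theorem isEvaluated_pair (hΩ : IsChamberLike w Ω) {A B : Entry σ} (h : IsAdmissible Ω [A, B])
    (hA0 : ∀ p ∈ Ω, 0 < energy w A.label p) (hB0 : ∀ p ∈ Ω, energy w B.label p < 0) :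
    IsEvaluated w Ω [A, B] := by
  have hμ : PosForm Ω 1 fun p => (1 : ℚ) * (energy w A.label p : ℚ) :=
    posForm_energy w _ _ fun p hp => by
      have : (0 : ℚ) < energy w A.label p := by exact_mod_cast hA0 p hp
      positivity
  simp only [one_mul] at hμ
  have hm : ∀ p ∈ Ω, ∃ m : ℕ, 0 < m ∧ energy w A.label p = m := fun p hp =>
    ⟨(energy w A.label p).toNat, by have := hA0 p hp; omega, by have := hA0 p hp; omega⟩
  have hμ1 : ∀ p ∈ Ω, ∃ m : ℕ, 0 < m ∧ (energy w A.label p : ℚ) = m := fun p hp => by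
    obtain ⟨m, h1, h2⟩ := hm p hp
    exact ⟨m, h1, by rw [h2]; rfl⟩
  have hu : A.label ∪ B.label = Finset.univ := by
    refine Finset.eq_univ_iff_forall.2 fun i => ?_
    obtain ⟨C, hC, hi⟩ := h.cover i
    simp only [List.mem_cons, List.not_mem_nil, or_false] at hC
    rcases hC with rfl | rfl
    · exact Finset.mem_union_left _ hi
    · exact Finset.mem_union_right _ hi
  have hAB : ∀ p ∈ Ω, energy w B.label p = -energy w A.label p := fun p hp => by
    have h1 := hΩ.energy_univ p hp
    rw [← hu, energy_union (by simpa using h.pairwise)] at h1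
    omega
  have hc : ∀ p ∈ Ω, ∀ m : ℕ, (energy w A.label p : ℚ) = m → correlator w [A, B] p =
      gridSum m fun c => A.symbol p c * B.symbol p c := by
    intro p hp m hm
    have hm : energy w A.label p = m := by exact_mod_cast hm
    have hB := hAB p hp
    rw [hm] at hB
    have hA1 := hA0 p hp
    simp only [correlator, List.map_cons, List.map_nil, List.prod_cons, List.prod_nil, mul_one,
      Entry.op, hB, hm]
    rw [symbolOp_mul_neg, vev_add, vev_add, vev_symbolOp_mul _ (by omega),
      ← one_mul (symbolOp 0 _), vev_mul_symbolOp 0 le_rfl, vev_smul, vev_one]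
    ring
  have key : ∀ D F, PosSymbol Ω D F →
      (∀ p, (fun c => A.symbol p c * B.symbol p c) = F p) →
      ∃ f, SharpPoly Ω D f ∧ ∀ p ∈ Ω, correlator w [A, B] p = energy w A.label p * f p := by
    intro D F hF hFp
    obtain ⟨f, hf, h1⟩ := hF.gridSum hΩ.nsmul_mem hμ hμ1
    refine ⟨f, hf, fun p hp => ?_⟩
    obtain ⟨m, _, hm⟩ := hμ1 p hp
    rw [hc p hp m hm, hFp, h1 p hp m hm, hm]
  have hvA := h.valid A (by simp)
  have hvB := h.valid B (by simp)
  match A, B with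
  | .current i, .current j =>
    -- Two currents give `m` while their weights give `m * m`, so no polynomial would be left; the
    -- composite entry in the list excludes this case.
    obtain ⟨C, hC, h2⟩ := h.composite
    simp only [List.mem_cons, List.not_mem_nil, or_false] at hC
    rcases hC with rfl | rfl <;> exact h2.elim
  | .current i, .composite T E G =>
    obtain ⟨f, hf, h1⟩ := key E G hvB fun p => by simp [Entry.symbol]
    refine ⟨f, hf.congr_degree (by simp [Entry.degree]), fun p hp => ?_⟩
    have hw : |(energy w {i} p : ℚ)| = energy w {i} p :=
      abs_of_pos (by exact_mod_cast hA0 p hp)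
    simp [h1 p hp, Entry.weight, hw, Entry.label]
  | .composite S D F, .current j =>
    obtain ⟨f, hf, h1⟩ := key D F hvA fun p => by simp [Entry.symbol]
    refine ⟨f, hf.congr_degree (by simp [Entry.degree]), fun p hp => ?_⟩
    have hw : |(energy w {j} p : ℚ)| = -energy w {j} p :=
      abs_of_neg (by exact_mod_cast hB0 p hp)
    -- The factor `m` of the grid sum is the energy of `S`, hence the weight of the current `j`.
    have h2 : (energy w {j} p : ℚ) = -energy w S p := by exact_mod_cast hAB p hp
    rw [h2, neg_neg] at hw
    simp [h1 p hp, Entry.weight, h2, hw, Entry.label, -abs_neg]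
  | .composite S D F, .composite T E G =>
    obtain ⟨f, hf, h1⟩ := key (D + E) _ (PosSymbol.mul hvA hvB) fun p => rfl
    refine ⟨_, (hf.form_mul hμ).congr_degree (by simp [Entry.degree]), fun p hp => ?_⟩
    simp [h1 p hp, Entry.weight]

/-- The commutator produces the weights of `A` and `B`, and the merged entry has weight 1 and degree
the sum of theirs. Both terms therefore have the same product of weights and the same degree. -/
theorem isEvaluated_of_commute (hΩ : IsChamberLike w Ω) {A B : Entry σ}
    {l₁ l₂ : List (Entry σ)} (h : IsAdmissible Ω (l₁ ++ A :: B :: l₂))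
    (hl : l₁ ++ l₂ ≠ [])
    (hA0 : ∀ p ∈ Ω, 0 < energy w A.label p) (hB0 : ∀ p ∈ Ω, energy w B.label p < 0)
    (h1 : IsEvaluated w Ω (l₁ ++ B :: A :: l₂))
    (h2 : ∀ L, IsAdmissible Ω L → L.length < (l₁ ++ A :: B :: l₂).length → IsEvaluated w Ω L) :
    IsEvaluated w Ω (l₁ ++ A :: B :: l₂) := by
  have hp : (l₁ ++ A :: B :: l₂).Perm (A :: B :: (l₁ ++ l₂)) :=
    List.perm_middle.trans (List.perm_middle.cons A)
  have h' := h.perm hp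
  obtain ⟨F, hF, hbr⟩ := exists_commutator (w := w) (h.valid A (by simp)) (h.valid B (by simp))
    hA0 hB0
  have hm := (h'.merge hF hl)
  have hd : Disjoint A.label B.label := (List.pairwise_cons.1 h'.pairwise).1 B (by simp)
  obtain ⟨f, hf, e1⟩ := h1
  obtain ⟨g, hg, e2⟩ := h2 _ (hm.perm List.perm_middle.symm) (by simp)
  refine ⟨_, (hf.congr_degree (by simp; ring)).add hΩ.nsmul_mem
    (hg.congr_degree (by simp [Entry.degree]; ring)), fun p hpΩ => ?_⟩
  -- The union of the labels is still a proper set, so there is no central term.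
  have hne : energy w A.label p + energy w B.label p ≠ 0 := by
    rw [← energy_union hd]
    rcases hm.sign hΩ List.mem_cons_self with h3 | h3
    · exact (h3 p hpΩ).ne'
    · exact (h3 p hpΩ).ne
  have e3 : correlator w (l₁ ++ A :: B :: l₂) p = correlator w (l₁ ++ B :: A :: l₂) p +
      A.weight w p * B.weight w p *
        correlator w (l₁ ++ .composite (A.label ∪ B.label) (A.degree + B.degree) F :: l₂) p := by
    simp only [correlator, List.map_append, List.map_cons, List.prod_append, List.prod_cons]
    rw [← vev_smul, ← vev_add]
    congr 1
    have e4 := symbolOp_mul _ _ hne (A.symbol p) (B.symbol p)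
    rw [hbr p hpΩ, symbolOp_mul_left, ← energy_union hd] at e4
    rw [← mul_assoc (A.op w p), ← mul_assoc (B.op w p)]
    unfold Entry.op at *
    rw [e4, add_mul, mul_add]
    simp only [smul_mul_assoc, mul_smul_comm]
    rfl
  rw [e3, e1 p hpΩ, e2 p hpΩ]
  simp only [List.map_append, List.map_cons, List.prod_append, List.prod_cons, Entry.weight]
  ring

/-- Moving the first operator of negative energy to the left. -/
theorem isEvaluated_append (hΩ : IsChamberLike w Ω) {N : ℕ}
    (ih : ∀ L, IsAdmissible Ω L → L.length < N → IsEvaluated w Ω L) {B : Entry σ}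
    (hB0 : ∀ p ∈ Ω, energy w B.label p < 0) (l₁ l₂ : List (Entry σ))
    (hl₁ : ∀ A ∈ l₁, ∀ p ∈ Ω, 0 < energy w A.label p) (h : IsAdmissible Ω (l₁ ++ B :: l₂))
    (hN : (l₁ ++ B :: l₂).length = N) : IsEvaluated w Ω (l₁ ++ B :: l₂) := by
  induction l₁ using List.reverseRecOn generalizing l₂ with
  | nil =>
    refine isEvaluated_of_eq_zero fun p hp => ?_
    simp only [correlator, List.nil_append, List.map_cons, List.prod_cons]
    exact vev_symbolOp_mul _ (hB0 p hp) _ _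
  | append_singleton l₁ A ih2 =>
    have hA0 := hl₁ A (by simp)
    rw [List.append_assoc, List.singleton_append] at h hN ⊢
    -- With no other operators left, the commutator has energy zero and the central term has to be
    -- used.
    by_cases hl : l₁ ++ l₂ = []
    · obtain ⟨rfl, rfl⟩ := List.append_eq_nil_iff.1 hl
      exact isEvaluated_pair hΩ h hA0 hB0
    · refine isEvaluated_of_commute hΩ h hl hA0 hB0 ?_ (hN ▸ ih)
      exact ih2 (A :: l₂) (fun C hC => hl₁ C (by simp [hC]))
        (h.perm ((List.Perm.swap B A l₂).append_left l₁)) (by simpa using hN)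

/-- Strong induction on the length: commutators shorten the list, and the reordered terms end with a
negative-energy operator in front. -/
theorem isEvaluated (hΩ : IsChamberLike w Ω) {L : List (Entry σ)} (h : IsAdmissible Ω L) :
    IsEvaluated w Ω L := by
  induction hN : L.length using Nat.strong_induction_on generalizing L with
  | _ N ih =>
    have split : ∀ L : List (Entry σ), (∀ A ∈ L, ∀ p ∈ Ω, 0 < energy w A.label p) ∨
        ∃ l₁ B l₂, L = l₁ ++ B :: l₂ ∧ (∀ A ∈ l₁, ∀ p ∈ Ω, 0 < energy w A.label p) ∧
          ¬ ∀ p ∈ Ω, 0 < energy w B.label p := by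
      intro L
      induction L with
      | nil => simp
      | cons C L ihL =>
        by_cases hC : ∀ p ∈ Ω, 0 < energy w C.label p
        · rcases ihL with h1 | ⟨l₁, B, l₂, rfl, h1, h2⟩
          · exact Or.inl fun A hA => by
              rcases List.mem_cons.1 hA with rfl | hA
              · exact hC
              · exact h1 A hA
          · refine Or.inr ⟨C :: l₁, B, l₂, rfl, fun A hA => ?_, h2⟩
            rcases List.mem_cons.1 hA with rfl | hA
            · exact hC
            · exact h1 A hA
        · exact Or.inr ⟨[], C, L, rfl, by simp, hC⟩
    rcases split L with h1 | ⟨l₁, B, l₂, rfl, h1, h2⟩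
    -- If all energies are positive, the rightmost operator already kills the vacuum.
    · refine isEvaluated_of_eq_zero fun p hp => ?_
      have hL : L ≠ [] := by
        rintro rfl
        exact absurd h.two_le (by simp)
      rw [← List.dropLast_append_getLast hL, correlator, List.map_append, List.prod_append]
      simp only [List.map_cons, List.map_nil, List.prod_cons, List.prod_nil, mul_one]
      exact vev_mul_symbolOp _ (h1 _ (List.getLast_mem hL) p hp).le _ _
    · have hB := (h.sign hΩ (A := B) (by simp)).resolve_left h2
      exact isEvaluated_append hΩ (fun L hL hlt => ih _ hlt hL rfl) hB l₁ l₂ h1 h hN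

end Evaluation

/-! ### Chambers are stable under dilation and fix the signs of energies -/

section Chamber

variable {n s : ℕ}

/-- The integral points of a subset of the hyperplane. -/
def integralPoints (C : Set ((Fin n → ℝ) × (Fin s → ℝ))) : Set (Fin n ⊕ Fin s → ℤ) :=
  {p | MemInt (fun i => p (.inl i)) (fun j => p (.inr j)) C}

/-- The signs of the energies: `x_i` for the Heisenberg operators, `-k_j` for the others. -/
def energySign : Fin n ⊕ Fin s → ℤ := Sum.elim (fun _ => 1) fun _ => -1

theorem energy_energySign (S : Finset (Fin n ⊕ Fin s)) (p : Fin n ⊕ Fin s → ℤ) :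
    energy energySign S p = ∑ i ∈ S.toLeft, p (.inl i) - ∑ j ∈ S.toRight, p (.inr j) := by
  conv_lhs => rw [energy, ← Finset.toLeft_disjSum_toRight (u := S), Finset.sum_disjSum]
  simp [energySign, sub_eq_add_neg]

/-- The linear form that defines a wall. -/
def wallForm (I : Finset (Fin n)) (T : Finset (Fin s)) (z : (Fin n → ℝ) × (Fin s → ℝ)) : ℝ :=
  ∑ i ∈ I, z.1 i - ∑ j ∈ T, z.2 j

theorem continuous_wallForm (I : Finset (Fin n)) (T : Finset (Fin s)) :
    Continuous (wallForm I T) := by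
  unfold wallForm
  fun_prop

theorem wallForm_ne_zero {I : Finset (Fin n)} {T : Finset (Fin s)}
    {z : (Fin n → ℝ) × (Fin s → ℝ)} (hz : z ∈ arrangementComplement n s)
    (h1 : ¬ (I = ∅ ∧ T = ∅)) (h2 : ¬ (I = Finset.univ ∧ T = Finset.univ)) :
    wallForm I T z ≠ 0 := fun h => hz.2 I T h1 h2 ⟨hz.1, sub_eq_zero.1 h⟩

theorem IsChamber.subset {C : Set ((Fin n → ℝ) × (Fin s → ℝ))} (hC : IsChamber C) :
    C ⊆ arrangementComplement n s := by
  obtain ⟨z, _, rfl⟩ := hC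
  exact connectedComponentIn_subset _ _

theorem IsChamber.isPreconnected {C : Set ((Fin n → ℝ) × (Fin s → ℝ))} (hC : IsChamber C) :
    IsPreconnected C := by
  obtain ⟨z, _, rfl⟩ := hC
  exact isPreconnected_connectedComponentIn

theorem smul_mem_arrangementComplement {z : (Fin n → ℝ) × (Fin s → ℝ)}
    (hz : z ∈ arrangementComplement n s) {c : ℝ} (hc : 0 < c) :
    c • z ∈ arrangementComplement n s := by
  refine ⟨?_, fun I T h1 h2 h3 => hz.2 I T h1 h2 ⟨hz.1, ?_⟩⟩
  · have := hz.1
    simp only [hyperplane, Set.mem_ofPred_eq, Prod.smul_fst, Prod.smul_snd, Pi.smul_apply,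
      smul_eq_mul, ← Finset.mul_sum] at this ⊢
    rw [this]
  · have := h3.2
    simp only [Prod.smul_fst, Prod.smul_snd, Pi.smul_apply, smul_eq_mul, ← Finset.mul_sum] at this
    exact mul_left_cancel₀ hc.ne' this

/-- The segment from `z` to `c • z` crosses no wall, since the walls are linear, and so stays in one
component. -/
theorem IsChamber.smul_mem {C : Set ((Fin n → ℝ) × (Fin s → ℝ))} (hC : IsChamber C)
    {z : (Fin n → ℝ) × (Fin s → ℝ)} (hz : z ∈ C) {c : ℝ} (hc : 1 ≤ c) : c • z ∈ C := by
  have hz' := hC.subset hz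
  obtain ⟨z₀, _, rfl⟩ := hC
  rw [connectedComponentIn_eq hz]
  have h1 : IsPreconnected ((fun a : ℝ => a • z) '' Set.Icc 1 c) :=
    isPreconnected_Icc.image _ (by fun_prop)
  refine h1.subset_connectedComponentIn ⟨1, ⟨le_rfl, hc⟩, one_smul _ _⟩ ?_ ⟨c, ⟨hc, le_rfl⟩, rfl⟩
  rintro _ ⟨a, ha, rfl⟩
  exact smul_mem_arrangementComplement hz' (one_pos.trans_le ha.1)

theorem IsChamber.isChamberLike {C : Set ((Fin n → ℝ) × (Fin s → ℝ))} (hC : IsChamber C) :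
    IsChamberLike energySign (integralPoints C) where
  nsmul_mem p hp t ht := by
    have := hC.smul_mem hp (c := t) (by exact_mod_cast ht)
    simp only [integralPoints, MemInt, Set.mem_ofPred_eq]
    convert this using 1
    ext <;> simp
  energy_univ p hp := by
    have h : ∑ i, (p (.inl i) : ℝ) = ∑ j, (p (.inr j) : ℝ) := (hC.subset hp).1
    rw [energy, Fintype.sum_sum_type]
    simp only [energySign, Sum.elim_inl, Sum.elim_inr, one_mul, neg_mul, Finset.sum_neg_distrib]
    have h' : ∑ i, p (.inl i) = ∑ j, p (.inr j) := by exact_mod_cast h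
    omega
  sign S h1 h2 := by
    have hS := Finset.toLeft_disjSum_toRight (u := S)
    have h0 : ∀ z ∈ C, wallForm S.toLeft S.toRight z ≠ 0 := fun z hz =>
      wallForm_ne_zero (hC.subset hz)
        (fun h => by rw [h.1, h.2] at hS; simp [← hS] at h1)
        (fun h => by
          rw [h.1, h.2] at hS
          exact h2 (by rw [← hS, Finset.univ_disjSum_univ]))
    have he : ∀ p : Fin n ⊕ Fin s → ℤ, (energy energySign S p : ℝ) =
        wallForm S.toLeft S.toRight (fun i => (p (.inl i) : ℝ), fun j => (p (.inr j) : ℝ)) := by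
      intro p
      simp [energy_energySign, wallForm]
    by_contra hcon
    simp only [not_or, not_forall, not_lt] at hcon
    obtain ⟨⟨p, hp, h3⟩, q, hq, h4⟩ := hcon
    have h3' : (energy energySign S p : ℝ) ≤ 0 := by exact_mod_cast h3
    have h4' : (0 : ℝ) ≤ energy energySign S q := by exact_mod_cast h4
    rw [he] at h3' h4'
    -- A change of sign would produce a zero of the wall form inside the connected chamber.
    obtain ⟨z, hz, hz0⟩ := hC.isPreconnected.intermediate_value hp hq
      (continuous_wallForm S.toLeft S.toRight).continuousOn ⟨h3', h4'⟩
    exact h0 z hz hz0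

end Chamber

/-! ### From correlators to Hurwitz numbers -/

section Hurwitz

variable {n s : ℕ}

/-- The operator attached to a coordinate. -/
def coordinateEntry (r : Fin s → ℕ) : Fin n ⊕ Fin s → Entry (Fin n ⊕ Fin s)
  | .inl i => .current (.inl i)
  | .inr j => .composite {.inr j} (r j) fun _ c => (r j : ℚ)⁻¹ * c ^ r j

theorem label_coordinateEntry (r : Fin s → ℕ) (a : Fin n ⊕ Fin s) :
    (coordinateEntry r a).label = {a} := by cases a <;> rfl

theorem isAdmissible_map_coordinateEntry (Ω : Set (Fin n ⊕ Fin s → ℤ)) (r : Fin s → ℕ)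
    (hn : 0 < n) (hs : 0 < s) {l : List (Fin n ⊕ Fin s)} (hl : l.Nodup) (hl' : ∀ a, a ∈ l) :
    IsAdmissible Ω (l.map (coordinateEntry r)) where
  nonempty A hA := by
    obtain ⟨a, _, rfl⟩ := List.mem_map.1 hA
    simp [label_coordinateEntry]
  valid A hA := by
    obtain ⟨a, _, rfl⟩ := List.mem_map.1 hA
    rcases a with i | j
    · trivial
    · exact .term (d := 0) _ (.const (by positivity)) (by simp)
  pairwise := by
    rw [List.pairwise_map]
    refine hl.imp fun h => ?_
    simpa [label_coordinateEntry] using h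
  cover a := ⟨_, List.mem_map_of_mem (hl' a), by simp [label_coordinateEntry]⟩
  composite := ⟨_, List.mem_map_of_mem (hl' (.inr ⟨0, hs⟩)), trivial⟩
  two_le := by
    rw [List.length_map, ← List.toFinset_card_of_nodup hl,
      Finset.eq_univ_iff_forall.2 fun a => List.mem_toFinset.2 (hl' a)]
    simp
    omega

theorem sum_degree_coordinateEntry (r : Fin s → ℕ) {l : List (Fin n ⊕ Fin s)} (hl : l.Nodup)
    (hl' : ∀ a, a ∈ l) :
    ((l.map (coordinateEntry r)).map Entry.degree).sum = ∑ j, (r j : ℤ) - n := by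
  rw [List.map_map, ← List.sum_toFinset _ hl,
    Finset.eq_univ_iff_forall.2 fun a => List.mem_toFinset.2 (hl' a), Fintype.sum_sum_type]
  simp [coordinateEntry, Entry.degree]
  ring

/-- The coordinates in the order of their operators on a chamber. -/
def coordinateList (p₀ : Fin n ⊕ Fin s → ℤ) : List (Fin n ⊕ Fin s) :=
  ((List.finRange n).filter fun i => 0 < p₀ (.inl i)).map .inl ++
    ((List.finRange s).map .inr ++
      ((List.finRange n).filter fun i => p₀ (.inl i) < 0).map .inl)

theorem nodup_coordinateList (p₀ : Fin n ⊕ Fin s → ℤ) : (coordinateList p₀).Nodup := by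
  have h1 := List.nodup_finRange n
  have h2 := List.nodup_finRange s
  unfold coordinateList
  rw [List.nodup_append', List.nodup_append']
  refine ⟨(h1.filter _).map Sum.inl_injective, ⟨h2.map Sum.inr_injective,
    (h1.filter _).map Sum.inl_injective, ?_⟩, ?_⟩
  · intro a ha hb
    simp only [List.mem_map] at ha hb
    obtain ⟨i, _, rfl⟩ := ha
    obtain ⟨j, _, h⟩ := hb
    cases h
  · intro a ha hb
    simp only [List.mem_append, List.mem_map, List.mem_filter, decide_eq_true_eq] at ha hb
    obtain ⟨i, ⟨_, hi⟩, rfl⟩ := ha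
    rcases hb with ⟨j, _, h⟩ | ⟨j, ⟨_, hj⟩, h⟩
    · cases h
    · cases h
      omega

theorem mem_coordinateList {p₀ : Fin n ⊕ Fin s → ℤ} (h : ∀ i, p₀ (.inl i) ≠ 0)
    (a : Fin n ⊕ Fin s) : a ∈ coordinateList p₀ := by
  unfold coordinateList
  rcases a with i | j
  · have := h i
    simp
    omega
  · simp

theorem posPart_eq (x : Fin n → ℤ) :
    posPart x = ((List.finRange n).filter fun i => 0 < x i).map fun i => (x i).natAbs := by
  rw [posPart, List.ofFn_eq_map, List.filter_map, List.map_map]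
  rfl

theorem negPart_eq (x : Fin n → ℤ) :
    negPart x = ((List.finRange n).filter fun i => x i < 0).map fun i => (x i).natAbs := by
  rw [negPart, List.ofFn_eq_map, List.filter_map, List.map_map]
  rfl

theorem energy_inl (i : Fin n) (p : Fin n ⊕ Fin s → ℤ) :
    energy energySign {.inl i} p = p (.inl i) := by simp [energy, energySign]

theorem energy_inr (j : Fin s) (p : Fin n ⊕ Fin s → ℤ) :
    energy energySign {.inr j} p = -p (.inr j) := by simp [energy, energySign]

theorem op_coordinateEntry_inl (r : Fin s → ℕ) (i : Fin n) (p : Fin n ⊕ Fin s → ℤ)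
    (h : p (.inl i) ≠ 0) :
    (coordinateEntry r (.inl i)).op energySign p = J (p (.inl i)) := by
  rw [J, calE_eq_symbolOp _ h, Entry.op, label_coordinateEntry, energy_inl]
  simp [coordinateEntry, Entry.symbol]

theorem op_coordinateEntry_inr (r : Fin s → ℕ) (j : Fin s) (p : Fin n ⊕ Fin s → ℤ)
    (h : p (.inr j) ≠ 0) : (coordinateEntry r (.inr j)).op energySign p =
      (r j : ℚ)⁻¹ • cutJoin (r j) (p (.inr j)) := by
  rw [cutJoin, calE_eq_symbolOp _ (neg_ne_zero.2 h), Entry.op, label_coordinateEntry, energy_inr,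
    ← symbolOp_mul_left, ← symbolOp_mul_left]
  congr 1
  funext c
  have : ((r j).factorial : ℚ) ≠ 0 := by exact_mod_cast (r j).factorial_ne_zero
  simp only [coordinateEntry, Entry.symbol]
  field_simp

/-- The signs of the `x_i` are constant on `Ω`, so the order of operators read off at `p₀` is right
at every `p`. The weights of the currents are the `|x_i|` and cancel the prefactor. All `k_j` are
non-zero, so the constant `1 / ς(u)` plays no role. -/
theorem hurwitzMap_eq {Ω : Set (Fin n ⊕ Fin s → ℤ)} (hΩ : IsChamberLike energySign Ω)
    (hn : 0 < n) (hs : 0 < s) (r : Fin s → ℕ) {p₀ p : Fin n ⊕ Fin s → ℤ} (hp₀ : p₀ ∈ Ω)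
    (hp : p ∈ Ω) {f : (Fin n ⊕ Fin s → ℤ) → ℚ}
    (hf : correlator energySign ((coordinateList p₀).map (coordinateEntry r)) p =
      (((coordinateList p₀).map (coordinateEntry r)).map fun A => A.weight energySign p).prod *
        f p) :
    hurwitzMap r (fun i => p (.inl i)) (fun j => p (.inr j)) = f p := by
  have hu : ∀ a b : Fin n ⊕ Fin s, a ≠ b → ({a} : Finset (Fin n ⊕ Fin s)) ≠ Finset.univ :=
    fun a b hab h => hab (Finset.mem_singleton.1 (h ▸ Finset.mem_univ b)).symm
  have hsign : ∀ i, (0 < p₀ (.inl i) ↔ 0 < p (.inl i)) ∧ (p₀ (.inl i) < 0 ↔ p (.inl i) < 0) ∧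
      p (.inl i) ≠ 0 := by
    intro i
    have h := hΩ.sign {.inl i} (by simp) (hu _ (.inr ⟨0, hs⟩) (by simp))
    simp only [energy_inl] at h
    rcases h with h | h <;> have h1 := h p₀ hp₀ <;> have h2 := h p hp <;> omega
  have hk : ∀ j, p (.inr j) ≠ 0 := by
    intro j
    have h := hΩ.sign {.inr j} (by simp) (hu _ (.inl ⟨0, hn⟩) (by simp))
    simp only [energy_inr] at h
    rcases h with h | h <;> have h2 := h p hp <;> omega
  have hJ : ∀ l : List (Fin n), (l.map fun i =>
      (coordinateEntry r (.inl i)).op energySign p) = l.map fun i => J (p (.inl i)) :=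
    fun l => List.map_congr_left fun i _ => op_coordinateEntry_inl r i p (hsign i).2.2
  have hpos : ((posPart fun i => p (.inl i)).map fun m => J (m : ℤ)) =
      ((List.finRange n).filter fun i => 0 < p₀ (.inl i)).map fun i => J (p (.inl i)) := by
    rw [posPart_eq, bind_pure_comp, List.map_eq_map, List.map_map, List.map_map]
    simp only [(hsign _).1]
    refine List.map_congr_left fun i hi => ?_
    have hi := of_decide_eq_true (List.mem_filter.1 hi).2
    simp only [Function.comp_apply]
    rw [Int.natAbs_of_nonneg hi.le]
  have hneg : ((negPart fun i => p (.inl i)).map fun m => J (-(m : ℤ))) =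
      ((List.finRange n).filter fun i => p₀ (.inl i) < 0).map fun i => J (p (.inl i)) := by
    rw [negPart_eq, bind_pure_comp, List.map_eq_map, List.map_map, List.map_map]
    simp only [(hsign _).2.1]
    refine List.map_congr_left fun i hi => ?_
    have hi := of_decide_eq_true (List.mem_filter.1 hi).2
    simp only [Function.comp_apply]
    rw [Int.ofNat_natAbs_of_nonpos hi.le, neg_neg]
  have hop : correlator energySign ((coordinateList p₀).map (coordinateEntry r)) p =
      vev (((posPart fun i => p (.inl i)).map fun m => J (m : ℤ)).prod *
        (List.ofFn fun j => (r j : ℚ)⁻¹ • cutJoin (r j) (p (.inr j))).prod *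
        ((negPart fun i => p (.inl i)).map fun m => J (-(m : ℤ))).prod) := by
    rw [hpos, hneg, correlator, coordinateList]
    simp only [List.map_append, List.map_map, List.prod_append, Function.comp_def, hJ,
      List.ofFn_eq_map, op_coordinateEntry_inr r _ p (hk _), mul_assoc]
  have hw : (((coordinateList p₀).map (coordinateEntry r)).map fun A =>
      A.weight energySign p).prod =
      ((posPart fun i => p (.inl i)).map fun m => (m : ℚ)).prod *
        ((negPart fun i => p (.inl i)).map fun m => (m : ℚ)).prod := by
    rw [posPart_eq, negPart_eq, coordinateList]
    simp only [bind_pure_comp, List.map_eq_map, List.map_append, List.map_map,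
      List.prod_append, Function.comp_def, (hsign _).1, (hsign _).2.1, coordinateEntry, Entry.weight, energy_inl, Nat.cast_natAbs,
      Int.cast_abs]
    simp
  have hw0 : ((posPart fun i => p (.inl i)).map fun m => (m : ℚ)).prod *
        ((negPart fun i => p (.inl i)).map fun m => (m : ℚ)).prod ≠ 0 := by
    rw [posPart_eq, negPart_eq]
    refine mul_ne_zero (List.prod_ne_zero ?_) (List.prod_ne_zero ?_) <;>
    · simp only [bind_pure_comp, List.map_eq_map, List.map_map, List.mem_map, Function.comp_apply,
        not_exists, not_and]
      intro i _
      have := (hsign i).2.2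
      exact_mod_cast Int.natAbs_ne_zero.2 this
  rw [hurwitzMap, hurwitz, ← hop, hf, hw, inv_mul_cancel_left₀ hw0]

/-! ### Growth along rays and the degree -/

theorem exists_evalInt_nsmul_le {σ : Type*} (Q : MvPolynomial σ ℚ) (p : σ → ℤ) :
    ∃ K : ℚ, ∀ t : ℕ, 1 ≤ t → evalInt (t • p) Q ≤ K * (t : ℚ) ^ Q.totalDegree := by
  refine ⟨∑ m ∈ Q.support, |Q.coeff m * ∏ i ∈ m.support, (p i : ℚ) ^ m i|, fun t ht => ?_⟩
  have ht' : (1 : ℚ) ≤ t := by exact_mod_cast ht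
  rw [evalInt, MvPolynomial.eval_eq, Finset.sum_mul]
  refine Finset.sum_le_sum fun m hm => ?_
  have h1 : ∏ i ∈ m.support, (((t • p) i : ℤ) : ℚ) ^ m i =
      (t : ℚ) ^ (∑ i ∈ m.support, m i) * ∏ i ∈ m.support, (p i : ℚ) ^ m i := by
    rw [← Finset.prod_pow_eq_pow_sum, ← Finset.prod_mul_distrib]
    refine Finset.prod_congr rfl fun i _ => ?_
    rw [← mul_pow]
    simp
  rw [h1, mul_left_comm, mul_comm]
  exact mul_le_mul (le_abs_self _) (pow_le_pow_right₀ ht' (MvPolynomial.le_totalDegree hm))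
    (by positivity) (abs_nonneg _)

theorem SharpPoly.le_totalDegree {σ : Type*} {Ω : Set (σ → ℤ)} {E : ℤ} {f : (σ → ℤ) → ℚ}
    (hf : SharpPoly Ω E f) {p : σ → ℤ} (hp : p ∈ Ω) (hfp : f p ≠ 0) {Q : MvPolynomial σ ℚ}
    (hQ : ∀ t : ℕ, 1 ≤ t → f (t • p) = evalInt (t • p) Q) : E ≤ Q.totalDegree := by
  by_contra! hlt
  obtain ⟨ε, hε, h1⟩ := hf.2.2 p hp hfp
  obtain ⟨K, hK⟩ := exists_evalInt_nsmul_le Q p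
  -- Beyond `K / ε` the lower bound `ε t ^ (deg Q + 1)` exceeds the upper bound `K t ^ (deg Q)`.
  obtain ⟨t, ht⟩ := exists_nat_gt (max 1 (K / ε))
  have ht1 : (1 : ℚ) < t := (le_max_left _ _).trans_lt ht
  have ht2 : K < ε * t := by
    have := (le_max_right _ _).trans_lt ht
    rw [div_lt_iff₀ hε] at this
    linarith
  have ht3 : 1 ≤ t := by exact_mod_cast ht1.le
  have h2 := (h1 t ht3).trans ((hQ t ht3).le.trans (hK t ht3))
  have h3 : (t : ℚ) ^ (Q.totalDegree + 1) ≤ (t : ℚ) ^ E := by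
    rw [← zpow_natCast]
    exact zpow_le_zpow_right₀ ht1.le (by push_cast; omega)
  have h4 := (mul_le_mul_of_nonneg_left h3 hε.le).trans h2
  rw [pow_succ'] at h4
  have h5 : (0 : ℚ) < (t : ℚ) ^ Q.totalDegree := by positivity
  nlinarith

end Hurwitz

end LeakyHurwitz

/-! ### The theorem -/

open LeakyHurwitz in
theorem mainTheorem2 (g n s : ℕ) (hn : 0 < n) (hs : 0 < s) (r : Fin s → ℕ)
    (hr : ∀ i, 0 < r i)
    (hg : ∑ i, ((r i : ℤ) - 1) = 2 * (g : ℤ) - 2 + (n : ℤ))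
    (C : Set ((Fin n → ℝ) × (Fin s → ℝ))) (hC : LeakyHurwitz.IsChamber C) :
    ∃ P : MvPolynomial (Fin n ⊕ Fin s) ℚ,
      LeakyHurwitz.Represents r C P ∧
      (P.totalDegree : ℤ) ≤ 1 + ∑ i, (r i : ℤ) - (n : ℤ) ∧
      ((∃ (x : Fin n → ℤ) (k : Fin s → ℤ),
          LeakyHurwitz.MemInt x k C ∧ LeakyHurwitz.hurwitzMap r x k ≠ 0) →
        ∀ Q : MvPolynomial (Fin n ⊕ Fin s) ℚ, LeakyHurwitz.Represents r C Q →
          1 + ∑ i, (r i : ℤ) - (n : ℤ) ≤ (Q.totalDegree : ℤ)) := by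
  -- By the genus condition `d = 2 g - 1 + s`, which is non-negative as `s > 0`. This is needed
  -- because `totalDegree` is a natural number, equal to 0 for the zero polynomial.
  have hd : 0 ≤ 1 + ∑ i, (r i : ℤ) - (n : ℤ) := by
    simp only [Finset.sum_sub_distrib, Finset.sum_const, Finset.card_univ, Fintype.card_fin,
      nsmul_eq_mul, mul_one] at hg
    omega
  by_cases hne : (integralPoints C).Nonempty
  swap
  · have he : ∀ x k, ¬ MemInt x k C := fun x k h => hne ⟨Sum.elim x k, h⟩
    -- The zero polynomial serves here, so the existence of integral points in a chamber need not be
    -- shown.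
    exact ⟨0, fun x k h => (he x k h).elim, by simpa using hd, fun ⟨x, k, h, _⟩ => (he x k h).elim⟩
  obtain ⟨p₀, hp₀⟩ := hne
  have hΩ := hC.isChamberLike
  have h0 : ∀ i, p₀ (.inl i) ≠ 0 := by
    intro i
    have h := hΩ.sign {.inl i} (by simp) fun h => by
      have := Finset.mem_univ (Sum.inr ⟨0, hs⟩ : Fin n ⊕ Fin s)
      rw [← h] at this
      simp at this
    simp only [energy_inl] at h
    rcases h with h | h <;> have h1 := h p₀ hp₀ <;> omega
  have hnd := nodup_coordinateList p₀
  have hmem := mem_coordinateList h0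
  obtain ⟨f, hf, hfp⟩ := isEvaluated hΩ
    (isAdmissible_map_coordinateEntry (integralPoints C) r hn hs hnd hmem)
  rw [sum_degree_coordinateEntry r hnd hmem] at hf
  have hh : ∀ p ∈ integralPoints C,
      hurwitzMap r (fun i => p (.inl i)) (fun j => p (.inr j)) = f p := fun p hp =>
    hurwitzMap_eq hΩ hn hs r hp₀ hp (hfp p hp)
  have hev : ∀ (x : Fin n → ℤ) (k : Fin s → ℤ) (P : MvPolynomial (Fin n ⊕ Fin s) ℚ),
      MvPolynomial.eval (Sum.elim (fun i => (x i : ℚ)) (fun j => (k j : ℚ))) P =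
        evalInt (Sum.elim x k) P := by
    intro x k P
    rw [evalInt]
    congr 2
    funext a
    cases a <;> rfl
  obtain ⟨P, hP, hfP⟩ := hf.1
  refine ⟨P, fun x k hxk => ?_, ?_, ?_⟩
  · rw [hev, ← hfP]
    exact hh (Sum.elim x k) hxk
  · have : P.totalDegree ≤ (1 + ∑ i, (r i : ℤ) - (n : ℤ)).toNat := by
      refine Finset.sup_le fun m hm => ?_
      have := hP m (MvPolynomial.mem_support_iff.1 hm)
      have h2 : m.degree = m.sum fun _ e => e := rfl
      omega
    omega
  · rintro ⟨x, k, hxk, hne⟩ Q hQ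
    have hp : Sum.elim x k ∈ integralPoints C := hxk
    have hfx : f (Sum.elim x k) ≠ 0 := by
      rw [← hh _ hp]
      exact hne
    have := hf.le_totalDegree hp hfx (Q := Q) fun t ht => by
      have ht' := hΩ.nsmul_mem _ hp t ht
      rw [← hh _ ht', hQ _ _ ht', hev]
      congr 2
      funext a
      cases a <;> rfl
    omega
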